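/- Let $K\ge 2$ be a fixed integer and $\beta\ge 1$ a fixed real, with $\beta<\sqrt{5/3}$ if $K\ge 3$. For $n\ge 2$ let $\Sigma_\beta$ be the set of labelings $\sigma:[n]\to[K]$ with $\frac{n}{\beta K}\le|\sigma^{-1}(k)|\le\frac{\beta n}{K}$ for all $k\in[K]$. For $\sigma_0\in\Sigma_\beta$ and $0\le b<a\le n$ let $A\sim\mathrm{SBM}(\sigma_0)$ be the random simple graph on $[n]$ whose pairs $i<j$ are independently edges, with probability $a/n$ if $\sigma_0(i)=\sigma_0(j)$ and $b/n$ otherwise. A mechanism $M$ assigns to each simple graph on $[n]$ a random labeling in $[K]^n$; it is $\varepsilon$-node-DP if $\mathbb P(M(G)\in S)\le e^{\varepsilon}\,\mathbb P(M(G')\in S)$ for all $S\subseteq[K]^n$ and all graphs $G,G'$ that differ only in edges incident to a single vertex. Put $$r(\sigma,\hat\sigma)=\min_{\pi\in S_K}\frac1n\sum_{i=1}^n\mathbf 1\{\sigma(i)\ne\pi(\hat\sigma(i))\},\qquad \mathcal R_\varepsilon(n,K,a,b,\beta)=\inf_{M\ \varepsilon\text{-node-DP}}\ \sup_{\sigma_0\in\Sigma_\beta}\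 \mathbb E\,r(\sigma_0,M(A)),$$ $$I=-2\log\Bigl(\sqrt{\tfrac an\tfrac bn}+\sqrt{(1-\tfrac an)(1-\tfrac bn)}\Bigr),\qquad \mathrm{Signal}=\begin{cases}nI/2,&K=2,\\ nI/(\beta K),&K\ge3.\end{cases}$$ Let $0<\rho_-\le\rho_+<1$. Then there are constants $L,c_{\mathrm{sig}},c_{\mathrm{priv}},C_{\mathrm{sig}},C_{\mathrm{priv}}>0$, depending only on $K,\beta,\rho_-,\rho_+$, such that the following holds for all sequences $a=a_n$, $b=b_n$ with $0\le b<a$ and $\rho_-\le b/a\le\rho_+$ for all large $n$, with $a,b=o(n)$ and $\log n=O(a)$. For all sufficiently large $n$ with $\Sigma_\beta\neq\emptyset$ and all $\varepsilon\ge L\log n$, $$e^{-C_{\mathrm{sig}}\mathrm{Signal}}+e^{-C_{\mathrm{priv}}\varepsilon}\ \le\ \mathcal R_\varepsilon(n,K,a,b,\beta)\ \le\ e^{-c_{\mathrm{sig}}\mathrm{Signal}}+e^{-c_{\mathrm{priv}}\varepsilon},$$ and moreover $\mathcal R_\varepsilon(n,K,a,b,\beta)=e^{-\theta_1\mathrm{Signal}}+e^{-\theta_2\varepsilon}$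 for some $\theta_1\in[c_{\mathrm{sig}},C_{\mathrm{sig}}]$ and $\theta_2\in[c_{\mathrm{priv}},C_{\mathrm{priv}}]$ (which may depend on $n$ and $\varepsilon$); that is, $\mathcal R_\varepsilon=\exp\{-\Theta(\mathrm{Signal})\}+\exp\{-\Theta(\varepsilon)\}$. -/

import Mathlib

open Filter Asymptotics

noncomputable section

namespace NodeSBM

/-- Labelings `σ : [n] → [K]`. -/
abbrev Labeling (n K : ℕ) : Type := Fin n → Fin K

/-- The set of `β`-balanced labelings: every class has size between `n/(βK)` and `βn/K`. -/
def balanced (n K : ℕ) (β : ℝ) : Set (Labeling n K) :=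
  {σ | ∀ k : Fin K,
    (n : ℝ) / (β * K) ≤ ((Finset.univ.filter fun i => σ i = k).card : ℝ) ∧
      ((Finset.univ.filter fun i => σ i = k).card : ℝ) ≤ β * n / K}

/-- Probability of an edge `ij`: `a/n` within a class and `b/n` across classes. -/
def edgeProb {n K : ℕ} (a b : ℝ) (σ : Labeling n K) (i j : Fin n) : ℝ :=
  if σ i = σ j then a / n else b / n

open Classical in
/-- The probability of the graph `G` under the stochastic block model with labeling `σ`:
the pairs `i < j` are independent, `ij` being an edge with probability `edgeProb a b σ i j`. -/
def sbmProb {n K : ℕ} (a b : ℝ) (σ : Labeling n K) (G : SimpleGraph (Fin n)) : ℝ :=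
  ∏ i : Fin n, ∏ j ∈ Finset.Ioi i,
    if G.Adj i j then edgeProb a b σ i j else 1 - edgeProb a b σ i j

/-- The mismatch ratio `r(σ, τ)`: the least normalized Hamming distance between `σ` and a
relabeling of `τ`. -/
def mismatch {n K : ℕ} (σ τ : Labeling n K) : ℝ :=
  ⨅ π : Equiv.Perm (Fin K), (hammingDist σ (fun i => π (τ i)) : ℝ) / n

/-- A (randomized) mechanism: to every graph on `[n]` the law of the labeling it outputs. -/
abbrev Mechanism (n K : ℕ) : Type := SimpleGraph (Fin n) → PMF (Labeling n K)

/-- Two graphs are node-adjacent if they differ only in edges incident to a single vertex. -/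
def NodeAdjacent {n : ℕ} (G G' : SimpleGraph (Fin n)) : Prop :=
  ∃ v : Fin n, ∀ i j : Fin n, i ≠ v → j ≠ v → (G.Adj i j ↔ G'.Adj i j)

/-- Pure `ε`-node-level differential privacy. -/
def IsNodeDP {n K : ℕ} (ε : ℝ) (M : Mechanism n K) : Prop :=
  ∀ G G' : SimpleGraph (Fin n), NodeAdjacent G G' → ∀ S : Set (Labeling n K),
    (M G).toOuterMeasure S ≤ ENNReal.ofReal (Real.exp ε) * (M G').toOuterMeasure S

open Classical in
/-- The expected mismatch `E r(σ, M(A))`, where `A` is drawn from the block model with labeling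
`σ`, and `M(A)` is then drawn by the mechanism. -/
def expectedMismatch {n K : ℕ} (a b : ℝ) (σ : Labeling n K) (M : Mechanism n K) : ℝ :=
  ∑ G : SimpleGraph (Fin n), sbmProb a b σ G *
    ∑ τ : Labeling n K, (M G τ).toReal * mismatch σ τ

/-- The node-private minimax risk: the infimum over all `ε`-node-DP mechanisms of the worst
expected mismatch over the `β`-balanced block models with parameters `a, b`. -/
def minimaxRisk (ε : ℝ) (n K : ℕ) (a b β : ℝ) : ℝ :=
  ⨅ M : {M : Mechanism n K // IsNodeDP ε M},
    ⨆ σ : balanced n K β, expectedMismatch a b σ.1 M.1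

/-- The Rényi divergence of order `1/2` between `Ber(a/n)` and `Ber(b/n)`. -/
def renyiHalf (n : ℕ) (a b : ℝ) : ℝ :=
  -2 * Real.log (Real.sqrt (a / n * (b / n)) + Real.sqrt ((1 - a / n) * (1 - b / n)))

/-- The signal: `nI/2` for two classes, `nI/(βK)` for more classes. -/
def signal (n K : ℕ) (a b β : ℝ) : ℝ :=
  if K = 2 then n * renyiHalf n a b / 2 else n * renyiHalf n a b / (β * K)

end NodeSBM

end

/-! For `b / a` bounded away from 0 and 1, the signal is of order `a`, with constants depending only
on `K`, `β` and the ratio bounds. So it suffices to prove that the risk is `exp(-Θ(a)) +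
exp(-Θ(ε))`.

Upper bound: the exponential mechanism is run with a score of node sensitivity one. `penalty`
measures how atypical a graph is for a labeling: its largest fluctuation towards a rival labeling,
net of a linear drift, plus its excess degrees. `score` is the Lipschitz regularization: some
vertices may be rewired freely, each at cost one. The true labeling has mean score at most `n` times
a constant times `exp(-ca)`, by exponential moments, a union over labelings and Jensen. Two
labelings cannot both score well on one graph: the sum of their scores is at least a constant times
`n * mismatch` (`mul_mismatch_le_score_add_score`). So an output either has mismatch of order score
over `n`, or has Gibbs weight exponentially small in `ε` times its number of errors. The sum over
labelings is harmless once `ε ≥ L log n`.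

Lower bound: Assouad's lemma on a cube of labelings obtained from linearly many disjoint
transpositions between two classes. One transposition affects two vertices, so it can be detected
neither beyond the likelihood ratio `exp(-Ca)` on graphs of moderate degree
(`graphMean_comparison`), nor beyond the privacy loss `exp(-2ε)` of resampling the edges at those
vertices (`IsNodeDP.graphMean_outMean_le`).

Finally, constants are absorbed into the rates, and continuity turns the two-sided bound into an
equality with intermediate rates. -/

noncomputable section

namespace NodeSBM

section

open scoped Classical

/-! ### Edge products, block-model expectations, exponential moments of degrees -/

/-- Unordered pairs of distinct vertices, as pairs `i < j`. -/
abbrev Pair (n : ℕ) : Type := {p : Fin n × Fin n // p.1 < p.2}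

lemma prod_Ioi_eq_prod_pair {n : ℕ} (f : Fin n → Fin n → ℝ) :
    ∏ i, ∏ j ∈ Finset.Ioi i, f i j = ∏ e : Pair n, f e.1.1 e.1.2 := by
  have h : ∀ i, ∏ j ∈ Finset.Ioi i, f i j = ∏ j, if i < j then f i j else 1 := by
    intro i
    rw [← Finset.prod_filter]
    congr 1
    ext j
    simp
  simp_rw [h]
  rw [← Fintype.prod_prod_type' (f := fun i j => if i < j then f i j else 1),
    ← Finset.prod_filter (fun p : Fin n × Fin n => p.1 < p.2) (fun p => f p.1 p.2)]
  exact Finset.prod_subtype _ (by simp) (fun p : Fin n × Fin n => f p.1 p.2)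

lemma sum_sum_eq_two_mul_sum_pair {n : ℕ} (f : Fin n → Fin n → ℝ)
    (hs : ∀ i j, f i j = f j i) (h0 : ∀ i, f i i = 0) :
    ∑ i, ∑ j, f i j = 2 * ∑ e : Pair n, f e.1.1 e.1.2 := by
  have h : ∑ i, ∑ j, (if i < j then f i j else 0) = ∑ e : Pair n, f e.1.1 e.1.2 := by
    rw [← Fintype.sum_prod_type' (f := fun i j => if i < j then f i j else 0),
      ← Finset.sum_filter (fun p : Fin n × Fin n => p.1 < p.2) (fun p => f p.1 p.2)]
    exact Finset.sum_subtype _ (by simp) (fun p : Fin n × Fin n => f p.1 p.2)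
  have h2 : ∑ i, ∑ j, (if j < i then f i j else 0) = ∑ e : Pair n, f e.1.1 e.1.2 := by
    rw [Finset.sum_comm, ← h]
    simp_rw [hs]
  have h3 : ∀ i j, f i j = (if i < j then f i j else 0) + (if j < i then f i j else 0) := by
    intro i j
    rcases lt_trichotomy i j with h | h | h
    · simp [h, h.not_gt]
    · subst h; simp [h0]
    · simp [h, h.not_gt]
  calc ∑ i, ∑ j, f i j
      = ∑ i, ∑ j, ((if i < j then f i j else 0) + (if j < i then f i j else 0)) := by
        simp_rw [← h3]
    _ = _ := by simp_rw [Finset.sum_add_distrib]; rw [h, h2]; ring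

/-- A graph on `Fin n` is the same as the indicator function of its edges. -/
def graphEquiv (n : ℕ) : SimpleGraph (Fin n) ≃ (Pair n → Bool) where
  toFun G e := decide (G.Adj e.1.1 e.1.2)
  invFun g := SimpleGraph.fromRel fun i j => ∃ h : i < j, g ⟨(i, j), h⟩ = true
  left_inv G := by
    ext i j
    simp only [SimpleGraph.fromRel_adj, decide_eq_true_eq]
    constructor
    · rintro ⟨-, ⟨-, h⟩ | ⟨-, h⟩⟩
      exacts [h, h.symm]
    · intro h
      exact ⟨h.ne, h.ne.lt_or_gt.imp (fun h1 => ⟨h1, h⟩) (fun h1 => ⟨h1, h.symm⟩)⟩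
  right_inv g := by
    ext ⟨⟨i, j⟩, h⟩
    have h' : i < j := h
    simp [SimpleGraph.fromRel_adj, h', h'.ne, h'.not_gt]

lemma sum_graph_prod {n : ℕ} (x y : Pair n → ℝ) :
    ∑ G : SimpleGraph (Fin n), ∏ e : Pair n, (if G.Adj e.1.1 e.1.2 then x e else y e)
      = ∏ e, (x e + y e) := by
  have h : ∏ e : Pair n, (x e + y e) = ∏ e : Pair n, ∑ c : Bool, if c then x e else y e := by
    simp
  rw [h, Finset.prod_univ_sum, Fintype.piFinset_univ]
  refine Fintype.sum_equiv (graphEquiv n) _ _ fun G => ?_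
  simp [graphEquiv]

/-- The indicator of the edge `ij`. -/
def adjInd {n : ℕ} (G : SimpleGraph (Fin n)) (i j : Fin n) : ℝ := if G.Adj i j then 1 else 0

lemma adjInd_comm {n : ℕ} (G : SimpleGraph (Fin n)) (i j : Fin n) :
    adjInd G i j = adjInd G j i := by
  simp [adjInd, G.adj_comm]

lemma adjInd_nonneg {n : ℕ} (G : SimpleGraph (Fin n)) (i j : Fin n) : 0 ≤ adjInd G i j := by
  unfold adjInd; split_ifs <;> norm_num

/-- The degree of a vertex, as a real number. -/
def rdeg {n : ℕ} (G : SimpleGraph (Fin n)) (v : Fin n) : ℝ := ∑ j, adjInd G v j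

/-- Expectation of a graph functional under the stochastic block model. -/
def graphMean {n K : ℕ} (a b : ℝ) (σ : Labeling n K) (f : SimpleGraph (Fin n) → ℝ) : ℝ :=
  ∑ G : SimpleGraph (Fin n), sbmProb a b σ G * f G

lemma sbmProb_eq_prod_pair {n K : ℕ} (a b : ℝ) (σ : Labeling n K) (G : SimpleGraph (Fin n)) :
    sbmProb a b σ G = ∏ e : Pair n, if G.Adj e.1.1 e.1.2 then edgeProb a b σ e.1.1 e.1.2
      else 1 - edgeProb a b σ e.1.1 e.1.2 := by
  unfold sbmProb
  exact prod_Ioi_eq_prod_pair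
    (fun i j => if G.Adj i j then edgeProb a b σ i j else 1 - edgeProb a b σ i j)

/-- Standing assumptions on the connectivity parameters. -/
structure Params (n : ℕ) (a b : ℝ) : Prop where
  n_pos : 0 < n
  b_nonneg : 0 ≤ b
  b_lt : b < a
  a_le : a ≤ n / 2

namespace Params
variable {n K : ℕ} {a b : ℝ}

lemma a_pos (h : Params n a b) : 0 < a := h.b_nonneg.trans_lt h.b_lt

lemma cast_pos (h : Params n a b) : (0 : ℝ) < n := by exact_mod_cast h.n_pos

lemma div_le (h : Params n a b) : a / n ≤ 1 / 2 := by
  rw [div_le_iff₀ h.cast_pos]; linarith [h.a_le]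

lemma edgeProb_le (h : Params n a b) (σ : Labeling n K) (i j : Fin n) :
    edgeProb a b σ i j ≤ a / n := by
  have := h.cast_pos
  unfold edgeProb; split_ifs
  · exact le_rfl
  · exact div_le_div_of_nonneg_right h.b_lt.le this.le

lemma edgeProb_nonneg (h : Params n a b) (σ : Labeling n K) (i j : Fin n) :
    0 ≤ edgeProb a b σ i j := by
  have := h.cast_pos
  unfold edgeProb; split_ifs
  · exact div_nonneg h.a_pos.le this.le
  · exact div_nonneg h.b_nonneg this.le

lemma edgeProb_le_half (h : Params n a b) (σ : Labeling n K) (i j : Fin n) :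
    edgeProb a b σ i j ≤ 1 / 2 := (h.edgeProb_le σ i j).trans h.div_le

lemma sbmProb_nonneg (h : Params n a b) (σ : Labeling n K) (G : SimpleGraph (Fin n)) :
    0 ≤ sbmProb a b σ G := by
  rw [sbmProb_eq_prod_pair]
  refine Finset.prod_nonneg fun e _ => ?_
  split_ifs
  · exact h.edgeProb_nonneg σ _ _
  · linarith [h.edgeProb_le_half σ e.1.1 e.1.2]

lemma graphMean_mono (h : Params n a b) (σ : Labeling n K) {f g : SimpleGraph (Fin n) → ℝ}
    (hfg : ∀ G, f G ≤ g G) : graphMean a b σ f ≤ graphMean a b σ g :=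
  Finset.sum_le_sum fun G _ => mul_le_mul_of_nonneg_left (hfg G) (h.sbmProb_nonneg σ G)

end Params

lemma graphMean_add {n K : ℕ} (a b : ℝ) (σ : Labeling n K) (f g : SimpleGraph (Fin n) → ℝ) :
    graphMean a b σ (fun G => f G + g G) = graphMean a b σ f + graphMean a b σ g := by
  simp [graphMean, mul_add, Finset.sum_add_distrib]

lemma graphMean_const_mul {n K : ℕ} (a b : ℝ) (σ : Labeling n K) (c : ℝ)
    (f : SimpleGraph (Fin n) → ℝ) :
    graphMean a b σ (fun G => c * f G) = c * graphMean a b σ f := by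
  simp [graphMean, Finset.mul_sum, mul_left_comm]

lemma graphMean_sum {n K : ℕ} {ι : Type*} (s : Finset ι) (a b : ℝ) (σ : Labeling n K)
    (f : ι → SimpleGraph (Fin n) → ℝ) :
    graphMean a b σ (fun G => ∑ t ∈ s, f t G) = ∑ t ∈ s, graphMean a b σ (f t) := by
  simp only [graphMean, Finset.mul_sum]
  exact Finset.sum_comm

lemma sum_sbmProb {n K : ℕ} (a b : ℝ) (σ : Labeling n K) :
    ∑ G : SimpleGraph (Fin n), sbmProb a b σ G = 1 := by
  simp_rw [sbmProb_eq_prod_pair]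
  rw [sum_graph_prod (fun e : Pair n => edgeProb a b σ e.1.1 e.1.2)
    (fun e : Pair n => 1 - edgeProb a b σ e.1.1 e.1.2)]
  simp

lemma graphMean_const {n K : ℕ} (a b : ℝ) (σ : Labeling n K) (c : ℝ) :
    graphMean a b σ (fun _ => c) = c := by
  simp [graphMean, ← Finset.sum_mul, sum_sbmProb]

/-- Independence factorizes the moment generating function over pairs, and each factor `1 + p(e^c -
1)` is at most `exp(p(e^c - 1))`. -/
lemma graphMean_exp_le {n K : ℕ} {a b : ℝ} (h : Params n a b) (σ : Labeling n K)
    (c : Pair n → ℝ) :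
    graphMean a b σ (fun G => Real.exp (∑ e, c e * adjInd G e.1.1 e.1.2))
      ≤ Real.exp (∑ e : Pair n, edgeProb a b σ e.1.1 e.1.2 * (Real.exp (c e) - 1)) := by
  have h1 : graphMean a b σ (fun G => Real.exp (∑ e, c e * adjInd G e.1.1 e.1.2))
      = ∏ e : Pair n, (edgeProb a b σ e.1.1 e.1.2 * Real.exp (c e)
          + (1 - edgeProb a b σ e.1.1 e.1.2)) := by
    rw [← sum_graph_prod]
    refine Finset.sum_congr rfl fun G _ => ?_
    beta_reduce
    rw [sbmProb_eq_prod_pair, Real.exp_sum, ← Finset.prod_mul_distrib]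
    refine Finset.prod_congr rfl fun e _ => ?_
    unfold adjInd
    split_ifs <;> simp
  rw [h1, Real.exp_sum]
  refine Finset.prod_le_prod (fun e _ => ?_) fun e _ => ?_
  · have h2 := h.edgeProb_nonneg σ e.1.1 e.1.2
    have h3 := h.edgeProb_le_half σ e.1.1 e.1.2
    have h4 := mul_nonneg h2 (Real.exp_pos (c e)).le
    linarith
  · refine le_trans (le_of_eq ?_) (Real.add_one_le_exp _)
    ring

/-- The two endpoints of a pair are distinct, so the weight is the indicator that the pair contains
`v`. This transfers row sums, such as degrees, to sums over independent pairs. -/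
lemma sum_pair_incident {n : ℕ} (f : Fin n → Fin n → ℝ) (hs : ∀ i j, f i j = f j i)
    (h0 : ∀ i, f i i = 0) (v : Fin n) :
    ∑ e : Pair n, ((if e.1.1 = v then 1 else 0) + (if e.1.2 = v then 1 else 0)) * f e.1.1 e.1.2
      = ∑ j, f v j := by
  have h := sum_sum_eq_two_mul_sum_pair
    (fun i j => ((if i = v then (1 : ℝ) else 0) + (if j = v then 1 else 0)) * f i j)
    (fun i j => by rw [hs i j, add_comm]) (fun i => by simp [h0])
  have h2 : ∑ i, ∑ j, ((if i = v then (1 : ℝ) else 0) + (if j = v then 1 else 0)) * f i j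
      = 2 * ∑ j, f v j := by
    simp_rw [add_mul, Finset.sum_add_distrib]
    rw [Finset.sum_comm (f := fun i j => (if j = v then (1 : ℝ) else 0) * f i j)]
    simp only [ite_mul, one_mul, zero_mul, Finset.sum_ite_irrel, Finset.sum_const_zero,
      Finset.sum_ite_eq', Finset.mem_univ, if_true]
    simp_rw [hs _ v]
    ring
  linarith

/-- Each of the fewer than `n` pairs at `v` contributes at most `(a/n)(e - 1) ≤ 2a/n`. Degrees above
`3a` therefore cost `exp(-a)`. -/
lemma graphMean_exp_rdeg_le {n K : ℕ} {a b : ℝ} (h : Params n a b) (σ : Labeling n K)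
    (v : Fin n) : graphMean a b σ (fun G => Real.exp (rdeg G v)) ≤ Real.exp (2 * a) := by
  set c : Pair n → ℝ := fun e => (if e.1.1 = v then 1 else 0) + (if e.1.2 = v then 1 else 0)
    with hc
  have hdeg : ∀ G : SimpleGraph (Fin n), rdeg G v = ∑ e, c e * adjInd G e.1.1 e.1.2 := fun G =>
    (sum_pair_incident (adjInd G) (adjInd_comm G) (fun i => by simp [adjInd]) v).symm
  simp_rw [hdeg]
  refine (graphMean_exp_le h σ c).trans (Real.exp_le_exp.2 ?_)
  have h1 : ∀ e : Pair n, edgeProb a b σ e.1.1 e.1.2 * (Real.exp (c e) - 1)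
      ≤ c e * (if e.1.1 = e.1.2 then 0 else 2 * (a / n)) := by
    intro e
    have he : e.1.1 ≠ e.1.2 := e.2.ne
    have hp := h.edgeProb_le σ e.1.1 e.1.2
    have hp0 := h.edgeProb_nonneg σ e.1.1 e.1.2
    have hexp := Real.exp_one_lt_d9
    have hexp1 := Real.add_one_le_exp (1 : ℝ)
    simp only [hc, he, if_false]
    by_cases h1 : e.1.1 = v
    · have h2 : e.1.2 ≠ v := fun h2 => he (h1.trans h2.symm)
      simp only [h1, h2, if_true, if_false, add_zero, one_mul] at hp hp0 ⊢
      nlinarith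
    · by_cases h2 : e.1.2 = v
      · simp only [h1, h2, if_true, if_false, zero_add, one_mul] at hp hp0 ⊢
        nlinarith
      · simp [h1, h2]
  refine (Finset.sum_le_sum fun e _ => h1 e).trans ?_
  rw [sum_pair_incident (fun i j : Fin n => if i = j then (0 : ℝ) else 2 * (a / n))
    (fun i j => by simp [eq_comm]) (by simp) v]
  have hn := h.cast_pos
  have ha := h.a_pos
  calc ∑ j, (if v = j then (0 : ℝ) else 2 * (a / n)) ≤ ∑ _j : Fin n, 2 * (a / n) := by
        refine Finset.sum_le_sum fun j _ => ?_
        split_ifs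
        · positivity
        · exact le_rfl
    _ = 2 * a := by simp; field_simp

/-! ### Co-membership differences and mismatch -/

/-- The difference of the co-membership indicators of two labelings. -/
def zdiff {n K : ℕ} (σ τ : Labeling n K) (i j : Fin n) : ℝ :=
  (if σ i = σ j then 1 else 0) - (if τ i = τ j then 1 else 0)

section zdiff
variable {n K : ℕ} (σ τ : Labeling n K)

lemma zdiff_comm (i j : Fin n) : zdiff σ τ i j = zdiff σ τ j i := by
  simp [zdiff, eq_comm]

@[simp] lemma zdiff_self (i : Fin n) : zdiff σ τ i i = 0 := by simp [zdiff]

lemma zdiff_swap (i j : Fin n) : zdiff τ σ i j = - zdiff σ τ i j := by simp [zdiff]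

lemma zdiff_perm_right (π : Equiv.Perm (Fin K)) (i j : Fin n) :
    zdiff σ (fun v => π (τ v)) i j = zdiff σ τ i j := by simp [zdiff]

lemma abs_zdiff_le_one (i j : Fin n) : |zdiff σ τ i j| ≤ 1 := by
  unfold zdiff; split_ifs <;> norm_num

lemma sq_zdiff (i j : Fin n) : zdiff σ τ i j ^ 2 = |zdiff σ τ i j| := by
  unfold zdiff; split_ifs <;> norm_num

/-- `zdiff` has the sign of the difference of edge probabilities, so testing with it loses no signal
to cancellation. -/
lemma edgeProb_sub_mul_zdiff (a b : ℝ) (i j : Fin n) :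
    (edgeProb a b σ i j - edgeProb a b τ i j) * zdiff σ τ i j
      = (a - b) / n * |zdiff σ τ i j| := by
  unfold zdiff edgeProb; split_ifs <;> simp <;> ring

lemma cast_hammingDist : (hammingDist σ τ : ℝ) = ∑ i, if σ i ≠ τ i then 1 else 0 := by
  rw [Finset.sum_boole]; rfl

/-- A pair can change status only if one of its endpoints is relabeled, and each vertex lies in
fewer than `n` pairs. -/
lemma sum_abs_zdiff_le : ∑ e : Pair n, |zdiff σ τ e.1.1 e.1.2| ≤ n * hammingDist σ τ := by
  have h := sum_sum_eq_two_mul_sum_pair (fun i j => |zdiff σ τ i j|)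
    (fun i j => by rw [zdiff_comm]) (by simp)
  have h2 : ∑ i, ∑ j, |zdiff σ τ i j|
      ≤ ∑ i, ∑ j, ((if σ i ≠ τ i then (1 : ℝ) else 0) + if σ j ≠ τ j then 1 else 0) := by
    refine Finset.sum_le_sum fun i _ => Finset.sum_le_sum fun j _ => ?_
    by_cases hi : σ i = τ i
    · by_cases hj : σ j = τ j
      · simp [zdiff, hi, hj]
      · simpa [hi, hj] using abs_zdiff_le_one σ τ i j
    · refine (abs_zdiff_le_one σ τ i j).trans ?_
      rw [if_pos hi]
      split_ifs <;> norm_num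
  simp_rw [Finset.sum_add_distrib, Finset.sum_const, nsmul_eq_mul, ← Finset.mul_sum,
    ← cast_hammingDist] at h2
  simp only [Finset.card_univ, Fintype.card_fin] at h2
  linarith

lemma hammingDist_perm (π : Equiv.Perm (Fin K)) :
    hammingDist (fun i => π (σ i)) (fun i => π (τ i)) = hammingDist σ τ := by
  simp [hammingDist]

lemma exists_mismatch_eq :
    ∃ π : Equiv.Perm (Fin K), mismatch σ τ = (hammingDist σ fun i => π (τ i) : ℝ) / n := by
  obtain ⟨π, h⟩ := exists_eq_ciInf_of_finite
    (f := fun π : Equiv.Perm (Fin K) => (hammingDist σ (fun i => π (τ i)) : ℝ) / n)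
  exact ⟨π, h.symm⟩

lemma mismatch_le (π : Equiv.Perm (Fin K)) :
    mismatch σ τ ≤ (hammingDist σ fun i => π (τ i) : ℝ) / n :=
  ciInf_le (Set.finite_range _).bddBelow π

lemma mismatch_nonneg : 0 ≤ mismatch σ τ := by
  obtain ⟨π, h⟩ := exists_mismatch_eq σ τ
  rw [h]; positivity

lemma mismatch_le_one : mismatch σ τ ≤ 1 := by
  obtain ⟨π, h⟩ := exists_mismatch_eq σ τ
  rw [h]
  refine div_le_one_of_le₀ ?_ (Nat.cast_nonneg n)
  exact_mod_cast (hammingDist_le_card_fintype.trans (by simp))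

/-- Align both labelings optimally with `τ`, then compose one alignment with the inverse of the
other. -/
lemma mismatch_triangle (ρ : Labeling n K) :
    mismatch σ ρ ≤ mismatch σ τ + mismatch ρ τ := by
  obtain ⟨π, h⟩ := exists_mismatch_eq σ τ
  obtain ⟨π', h'⟩ := exists_mismatch_eq ρ τ
  rw [h, h', ← add_div]
  refine (mismatch_le σ ρ (π'.symm.trans π)).trans
    (div_le_div_of_nonneg_right ?_ (Nat.cast_nonneg n))
  have h1 := hammingDist_triangle σ (fun i => π (τ i)) (fun i => (π'.symm.trans π) (ρ i))
  have h2 := hammingDist_perm (fun i => π' (τ i)) ρ (π'.symm.trans π)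
  have h3 : (fun i => (π'.symm.trans π) (π' (τ i))) = fun i => π (τ i) := by
    ext i; simp
  rw [h3, hammingDist_comm _ ρ] at h2
  rw [h2] at h1
  exact_mod_cast h1

/-- Two labelings that differ in many places, up to relabeling, have many pairs of vertices with
different co-membership status. -/
lemma mul_mismatch_le_sum_abs_zdiff {β : ℝ} (hn : 0 < n) (hK : 2 ≤ K) (hβ : 1 ≤ β)
    (hσ : σ ∈ balanced n K β) :
    n * (n * mismatch σ τ) ≤ 2 * (β * K) ^ 2 * ∑ e : Pair n, |zdiff σ τ e.1.1 e.1.2| := by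
  have hn' : (0 : ℝ) < n := by exact_mod_cast hn
  have hK' : (2 : ℝ) ≤ K := by exact_mod_cast hK
  have hβK : 2 ≤ β * K := by nlinarith
  have hsum := sum_sum_eq_two_mul_sum_pair (fun i j => |zdiff σ τ i j|)
    (fun i j => by rw [zdiff_comm]) (by simp)
  set m : ℝ := n * mismatch σ τ with hm
  have hmn : m ≤ n := by
    have := mismatch_le_one σ τ
    nlinarith
  set N : Fin n → ℝ := fun i => ∑ j, |zdiff σ τ i j| with hN
  by_contra! hlt
  have hlt' : (β * K) ^ 2 * ∑ i, N i < n * m := by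
    simp only [hN]; rw [hsum]; linarith
  have hN0 : ∀ i, 0 ≤ N i := fun i => Finset.sum_nonneg fun j _ => abs_nonneg _
  -- Averaging: each class has at least `n/(βK)` vertices, so if all of them had many discrepancies,
  -- the total would exceed the assumed bound.
  have hrep : ∀ k : Fin K, ∃ i, σ i = k ∧ (β * K) * N i < m := by
    intro k
    by_contra! hk
    have h1 : ∑ i ∈ Finset.univ.filter (fun i => σ i = k), m
        ≤ ∑ i ∈ Finset.univ.filter (fun i => σ i = k), (β * K) * N i :=
      Finset.sum_le_sum fun i hi => hk i (by simpa using hi)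
    have h2 : ∑ i ∈ Finset.univ.filter (fun i => σ i = k), (β * K) * N i
        ≤ ∑ i, (β * K) * N i :=
      Finset.sum_le_sum_of_subset_of_nonneg (Finset.subset_univ _)
        fun i _ _ => mul_nonneg (by linarith) (hN0 i)
    rw [Finset.sum_const, nsmul_eq_mul] at h1
    rw [← Finset.mul_sum (f := N) (s := Finset.univ)] at h2
    have h3 := (hσ k).1
    rw [div_le_iff₀ (by linarith)] at h3
    have hm0 : 0 ≤ m := mul_nonneg hn'.le (mismatch_nonneg σ τ)
    nlinarith [mul_le_mul_of_nonneg_right h3 hm0,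
      mul_le_mul_of_nonneg_left (h1.trans h2) (by linarith : 0 ≤ β * K)]
  choose r hr1 hr2 using hrep
  have hcard : ∀ k, (n : ℝ) / (β * K)
      ≤ ∑ j, if σ j = k then (1 : ℝ) else 0 := by
    intro k
    simpa using (hσ k).1
  -- If two representatives shared a `τ`-class, every vertex of either `σ`-class would be a
  -- discrepancy for one of them. Then `N (r k) + N (r l) ≥ 2n/(βK)`, whereas each is below `m/(βK)
  -- ≤ n/(βK)`.
  have hinj : Function.Injective fun k => τ (r k) := by
    intro k l hkl
    by_contra hne
    have h1 : ∑ j, ((if σ j = k then (1 : ℝ) else 0) + if σ j = l then 1 else 0)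
        ≤ ∑ j, (|zdiff σ τ (r k) j| + |zdiff σ τ (r l) j|) := by
      refine Finset.sum_le_sum fun j _ => ?_
      have hkl' : τ (r k) = τ (r l) := hkl
      by_cases h1 : σ j = k
      · have h2 : σ j ≠ l := fun h => hne (h1.symm.trans h)
        have h3 : l ≠ k := fun h => hne h.symm
        simp only [zdiff, hr1, h1, hkl', if_true, h3, if_false, hne]
        split_ifs <;> norm_num
      · by_cases h2 : σ j = l
        · simp only [zdiff, hr1, h2, hkl', if_true, hne, if_false]
          have h3 : l ≠ k := fun h => hne h.symm
          simp only [h3, if_false]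
          split_ifs <;> norm_num
        · simp only [h1, h2, if_false, add_zero]
          positivity
    simp_rw [Finset.sum_add_distrib] at h1
    have h2 := hcard k
    have h3 := hcard l
    have h4 : (β * K) * (n / (β * K) + n / (β * K)) ≤ (β * K) * (N (r k) + N (r l)) :=
      mul_le_mul_of_nonneg_left (by simp only [hN]; linarith) (by linarith)
    have h5 : (β * K) * (n / (β * K) + n / (β * K)) = 2 * n := by field_simp; ring
    have := hr2 k
    have := hr2 l
    linarith
  let p : Equiv.Perm (Fin K) := Equiv.ofBijective _ (Finite.injective_iff_bijective.1 hinj)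
  have hp : ∀ k, p k = τ (r k) := fun k => rfl
  have hle := mismatch_le σ τ p.symm
  rw [cast_hammingDist, le_div_iff₀ hn'] at hle
  -- A vertex mislabeled by `p⁻¹` shares the `σ`-class of its representative but not its `τ`-class,
  -- so it is counted in that representative's `N`.
  have h1 : ∀ j, (if σ j ≠ p.symm (τ j) then (1 : ℝ) else 0)
      ≤ ∑ k, (if σ j = k then 1 else 0) * |zdiff σ τ (r k) j| := by
    intro j
    simp only [ite_mul, one_mul, zero_mul, Finset.sum_ite_eq, Finset.mem_univ, if_true]
    split_ifs with h
    · have h2 : τ (r (σ j)) ≠ τ j := by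
        intro h3
        apply h
        rw [← h3, ← hp, Equiv.symm_apply_apply]
      simp [zdiff, hr1, h2]
    · positivity
  have h2 : mismatch σ τ * n ≤ ∑ k, N (r k) := by
    refine hle.trans ((Finset.sum_le_sum fun j _ => h1 j).trans ?_)
    rw [Finset.sum_comm]
    refine Finset.sum_le_sum fun k _ => Finset.sum_le_sum fun j _ => ?_
    have := abs_nonneg (zdiff σ τ (r k) j)
    split_ifs <;> simp [this]
  have h3 : ∑ k, (β * K) * N (r k) < ∑ _k : Fin K, m := by
    have : Nonempty (Fin K) := ⟨⟨0, by omega⟩⟩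
    exact Finset.sum_lt_sum_of_nonempty Finset.univ_nonempty fun k _ => hr2 k
  rw [← Finset.mul_sum] at h3
  simp only [Finset.sum_const, Finset.card_univ, Fintype.card_fin, nsmul_eq_mul] at h3
  have hm0 : 0 ≤ m := mul_nonneg hn'.le (mismatch_nonneg σ τ)
  have h4 : β * K * m ≤ β * K * ∑ k, N (r k) :=
    mul_le_mul_of_nonneg_left (by rw [hm]; linarith) (by linarith)
  nlinarith [mul_nonneg (mul_nonneg (sub_nonneg.2 hβ) (by linarith : (0 : ℝ) ≤ K)) hm0]

end zdiff

/-! ### Fluctuation moments and the Hamming generating function -/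

lemma exp_sub_one_sub_le_sq {t : ℝ} (ht : |t| ≤ 1) : Real.exp t - 1 - t ≤ t ^ 2 := by
  have := Real.abs_exp_sub_one_sub_id_le ht
  exact (le_abs_self _).trans this

/-- Sub-Gaussian bound for the fluctuation of the co-membership statistic. -/
lemma graphMean_exp_fluctuation_le {n K : ℕ} {a b : ℝ} (h : Params n a b) (σ τ : Labeling n K)
    {l : ℝ} (hl0 : 0 ≤ l) (hl1 : l ≤ 1) :
    graphMean a b σ (fun G => Real.exp (l * ∑ e : Pair n,
        (edgeProb a b σ e.1.1 e.1.2 - adjInd G e.1.1 e.1.2) * zdiff σ τ e.1.1 e.1.2))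
      ≤ Real.exp (l ^ 2 * a * hammingDist σ τ) := by
  set D : ℝ := ∑ e : Pair n, l * (edgeProb a b σ e.1.1 e.1.2 * zdiff σ τ e.1.1 e.1.2) with hD
  have h1 : ∀ G : SimpleGraph (Fin n), Real.exp (l * ∑ e : Pair n,
        (edgeProb a b σ e.1.1 e.1.2 - adjInd G e.1.1 e.1.2) * zdiff σ τ e.1.1 e.1.2)
      = Real.exp D * Real.exp (∑ e : Pair n,
          (-l * zdiff σ τ e.1.1 e.1.2) * adjInd G e.1.1 e.1.2) := by
    intro G
    rw [← Real.exp_add, hD, Finset.mul_sum, ← Finset.sum_add_distrib]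
    congr 1
    refine Finset.sum_congr rfl fun e _ => by ring
  simp_rw [h1]
  rw [graphMean_const_mul]
  refine (mul_le_mul_of_nonneg_left (graphMean_exp_le h σ _) (Real.exp_pos _).le).trans ?_
  rw [← Real.exp_add, Real.exp_le_exp, hD, ← Finset.sum_add_distrib]
  have hn := h.cast_pos
  have ha := h.a_pos
  calc _ ≤ ∑ e : Pair n, (l ^ 2 * (a / n)) * |zdiff σ τ e.1.1 e.1.2| := by
        refine Finset.sum_le_sum fun e _ => ?_
        have hz := abs_zdiff_le_one σ τ e.1.1 e.1.2
        have ht : |-l * zdiff σ τ e.1.1 e.1.2| ≤ 1 := by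
          rw [abs_mul, abs_neg, abs_of_nonneg hl0]
          have := abs_nonneg (zdiff σ τ e.1.1 e.1.2)
          nlinarith
        have h3 := exp_sub_one_sub_le_sq ht
        have h4 := h.edgeProb_nonneg σ e.1.1 e.1.2
        have h5 := h.edgeProb_le σ e.1.1 e.1.2
        have h6 : (-l * zdiff σ τ e.1.1 e.1.2) ^ 2 = l ^ 2 * |zdiff σ τ e.1.1 e.1.2| := by
          rw [mul_pow, sq_zdiff]; ring
        have h7 : 0 ≤ l ^ 2 * |zdiff σ τ e.1.1 e.1.2| := by positivity
        rw [h6] at h3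
        nlinarith [mul_le_mul_of_nonneg_left h3 h4, mul_le_mul_of_nonneg_right h5 h7]
    _ = l ^ 2 * (a / n) * ∑ e : Pair n, |zdiff σ τ e.1.1 e.1.2| := by rw [Finset.mul_sum]
    _ ≤ l ^ 2 * (a / n) * (n * hammingDist σ τ) :=
        mul_le_mul_of_nonneg_left (sum_abs_zdiff_le σ τ) (by positivity)
    _ = l ^ 2 * a * hammingDist σ τ := by field_simp

lemma sum_pow_hammingDist {n K : ℕ} (σ : Labeling n K) (hK : 1 ≤ K) (x : ℝ) :
    ∑ τ : Labeling n K, x ^ hammingDist σ τ = (1 + (K - 1) * x) ^ n := by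
  have h1 : ∀ τ : Labeling n K, x ^ hammingDist σ τ = ∏ i, if τ i = σ i then 1 else x := by
    intro τ
    rw [Finset.prod_ite]
    simp [hammingDist, eq_comm]
  have h2 : ∀ i, ∑ k : Fin K, (if k = σ i then (1 : ℝ) else x) = 1 + (K - 1) * x := by
    intro i
    rw [← Finset.add_sum_erase _ _ (Finset.mem_univ (σ i))]
    rw [Finset.sum_congr rfl (g := fun _ => x) (fun k hk => by simp [(Finset.mem_erase.1 hk).1])]
    simp [Finset.card_erase_of_mem, Nat.cast_sub hK]
  simp_rw [h1]
  have h3 := Finset.prod_univ_sum (fun _ : Fin n => (Finset.univ : Finset (Fin K)))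
    (fun i k => if k = σ i then (1 : ℝ) else x)
  rw [Fintype.piFinset_univ] at h3
  rw [← h3]
  simp [h2]

lemma sum_pow_hammingDist_le {n K : ℕ} (σ : Labeling n K) (hK : 1 ≤ K) {x : ℝ} (hx : 0 ≤ x) :
    ∑ τ : Labeling n K, x ^ hammingDist σ τ ≤ Real.exp (n * K * x) := by
  rw [sum_pow_hammingDist σ hK]
  have hK' : (1 : ℝ) ≤ K := by exact_mod_cast hK
  have h0 : 0 ≤ 1 + ((K : ℝ) - 1) * x := by nlinarith
  calc (1 + ((K : ℝ) - 1) * x) ^ n ≤ Real.exp (K * x) ^ n := by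
        refine pow_le_pow_left₀ h0 ?_ n
        linarith [Real.add_one_le_exp (K * x)]
    _ = Real.exp (n * K * x) := by rw [← Real.exp_nat_mul, mul_assoc]

/-! ### The exponential mechanism -/

/-- The pointwise form of a mechanism given by real probabilities is node-private as soon as the
probabilities of neighbouring graphs are comparable. -/
lemma isNodeDP_of_apply_le {n K : ℕ} {ε : ℝ} {M : Mechanism n K}
    (h : ∀ G G' : SimpleGraph (Fin n), NodeAdjacent G G' → ∀ τ,
      M G τ ≤ ENNReal.ofReal (Real.exp ε) * M G' τ) : IsNodeDP ε M := by
  intro G G' hG S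
  rw [PMF.toOuterMeasure_apply, PMF.toOuterMeasure_apply, ← ENNReal.tsum_mul_left]
  refine ENNReal.tsum_le_tsum fun τ => ?_
  by_cases hτ : τ ∈ S
  · simpa [hτ] using h G G' hG τ
  · simp [hτ]

/-- The Gibbs weights of the exponential mechanism. -/
def gibbs {n K : ℕ} (ε : ℝ) (s : Labeling n K → ℝ) (τ : Labeling n K) : ℝ :=
  Real.exp (-(ε / 2) * s τ) / ∑ ρ, Real.exp (-(ε / 2) * s ρ)

section gibbs
variable {n K : ℕ} {ε : ℝ} (s : Labeling n K → ℝ)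

lemma gibbs_nonneg (τ : Labeling n K) : 0 ≤ gibbs ε s τ :=
  div_nonneg (Real.exp_pos _).le (Finset.sum_nonneg fun _ _ => (Real.exp_pos _).le)

lemma sum_gibbs [Nonempty (Labeling n K)] : ∑ τ, gibbs ε s τ = 1 := by
  unfold gibbs
  rw [← Finset.sum_div, div_self]
  exact (Finset.sum_pos (fun _ _ => Real.exp_pos _) Finset.univ_nonempty).ne'

/-- The normalizer is at least its single term at `σ`. -/
lemma gibbs_le (σ τ : Labeling n K) : gibbs ε s τ ≤ Real.exp (-(ε / 2) * (s τ - s σ)) := by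
  have h : Real.exp (-(ε / 2) * s σ) ≤ ∑ ρ, Real.exp (-(ε / 2) * s ρ) :=
    Finset.single_le_sum (f := fun ρ => Real.exp (-(ε / 2) * s ρ))
      (fun _ _ => (Real.exp_pos _).le) (Finset.mem_univ σ)
  refine (div_le_div_of_nonneg_left (Real.exp_pos _).le (Real.exp_pos _) h).trans (le_of_eq ?_)
  rw [← Real.exp_sub]; congr 1; ring

/-- Half of the budget pays for the change of the numerator, half for that of the normalizer. -/
lemma gibbs_le_exp_mul [Nonempty (Labeling n K)] (hε : 0 ≤ ε) (s' : Labeling n K → ℝ)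
    (h : ∀ τ, s τ ≤ s' τ + 1) (h' : ∀ τ, s' τ ≤ s τ + 1) (τ : Labeling n K) :
    gibbs ε s τ ≤ Real.exp ε * gibbs ε s' τ := by
  unfold gibbs
  have hp : ∀ t : Labeling n K → ℝ, 0 < ∑ ρ, Real.exp (-(ε / 2) * t ρ) := fun t =>
    Finset.sum_pos (fun _ _ => Real.exp_pos _) Finset.univ_nonempty
  rw [← mul_div_assoc, div_le_div_iff₀ (hp s) (hp s')]
  have h1 : Real.exp (-(ε / 2) * s τ) ≤ Real.exp (ε / 2) * Real.exp (-(ε / 2) * s' τ) := by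
    rw [← Real.exp_add, Real.exp_le_exp]; nlinarith [h' τ]
  have h2 : ∑ ρ, Real.exp (-(ε / 2) * s' ρ)
      ≤ Real.exp (ε / 2) * ∑ ρ, Real.exp (-(ε / 2) * s ρ) := by
    rw [Finset.mul_sum]
    refine Finset.sum_le_sum fun ρ _ => ?_
    rw [← Real.exp_add, Real.exp_le_exp]; nlinarith [h ρ]
  have h3 : Real.exp ε = Real.exp (ε / 2) * Real.exp (ε / 2) := by
    rw [← Real.exp_add]; congr 1; ring
  refine (mul_le_mul h1 h2 (hp s').le (by positivity)).trans (le_of_eq ?_)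
  rw [h3]; ring

end gibbs

/-- The exponential mechanism with a given score (small scores are favoured). -/
def expMechanism {n K : ℕ} [Nonempty (Labeling n K)] (ε : ℝ)
    (s : SimpleGraph (Fin n) → Labeling n K → ℝ) : Mechanism n K := fun G =>
  PMF.ofFintype (fun τ => ENNReal.ofReal (gibbs ε (s G) τ)) (by
    rw [← ENNReal.ofReal_sum_of_nonneg fun τ _ => gibbs_nonneg _ τ, sum_gibbs, ENNReal.ofReal_one])

lemma isNodeDP_expMechanism {n K : ℕ} [Nonempty (Labeling n K)] {ε : ℝ} (hε : 0 ≤ ε)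
    (s : SimpleGraph (Fin n) → Labeling n K → ℝ)
    (hs : ∀ G G', NodeAdjacent G G' → ∀ τ, s G τ ≤ s G' τ + 1) :
    IsNodeDP ε (expMechanism ε s) := by
  refine isNodeDP_of_apply_le fun G G' hG τ => ?_
  have hG' : NodeAdjacent G' G := by
    obtain ⟨v, hv⟩ := hG
    exact ⟨v, fun i j hi hj => (hv i j hi hj).symm⟩
  simp only [expMechanism, PMF.ofFintype_apply]
  rw [← ENNReal.ofReal_mul (Real.exp_pos _).le]
  exact ENNReal.ofReal_le_ofReal
    (gibbs_le_exp_mul (s G) hε (s G') (hs G G' hG) (hs G' G hG') τ)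

lemma expMechanism_toReal {n K : ℕ} [Nonempty (Labeling n K)] (ε : ℝ)
    (s : SimpleGraph (Fin n) → Labeling n K → ℝ) (G : SimpleGraph (Fin n)) (τ : Labeling n K) :
    (expMechanism ε s G τ).toReal = gibbs ε (s G) τ := by
  simp [expMechanism, gibbs_nonneg]

/-! ### The node-Lipschitz score and its separation property -/

/-- The largest excess fluctuation of a graph in a direction that confuses `τ` with another
labeling. -/
def fluct {n K : ℕ} (a b δ : ℝ) (τ : Labeling n K) (H : SimpleGraph (Fin n)) : ℝ :=
  ⨆ ρ : Labeling n K, (∑ e : Pair n,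
    (edgeProb a b τ e.1.1 e.1.2 - adjInd H e.1.1 e.1.2) * zdiff τ ρ e.1.1 e.1.2
      - δ * a * hammingDist τ ρ)

/-- The total excess of the degrees above `3a`. -/
def degExcess {n : ℕ} (a : ℝ) (H : SimpleGraph (Fin n)) : ℝ := ∑ v, max (rdeg H v - 3 * a) 0

/-- How atypical the graph `H` is for the block model with labeling `τ`, in units of vertices. -/
def penalty {n K : ℕ} (a b δ : ℝ) (τ : Labeling n K) (H : SimpleGraph (Fin n)) : ℝ :=
  (fluct a b δ τ H + degExcess a H) / a

/-- The node-Lipschitz regularization of `penalty`. -/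
def score {n K : ℕ} (a b δ : ℝ) (G : SimpleGraph (Fin n)) (τ : Labeling n K) : ℝ :=
  ⨅ q : {q : SimpleGraph (Fin n) × Finset (Fin n) //
      ∀ i j, i ∉ q.2 → j ∉ q.2 → (G.Adj i j ↔ q.1.Adj i j)},
    ((q.1.2.card : ℝ) + penalty a b δ τ q.1.1)

section score
variable {n K : ℕ} {a b δ : ℝ}

lemma le_fluct (τ ρ : Labeling n K) (H : SimpleGraph (Fin n)) :
    ∑ e : Pair n, (edgeProb a b τ e.1.1 e.1.2 - adjInd H e.1.1 e.1.2) * zdiff τ ρ e.1.1 e.1.2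
      - δ * a * hammingDist τ ρ ≤ fluct a b δ τ H :=
  le_ciSup (f := fun ρ : Labeling n K => ∑ e : Pair n,
    (edgeProb a b τ e.1.1 e.1.2 - adjInd H e.1.1 e.1.2) * zdiff τ ρ e.1.1 e.1.2
      - δ * a * hammingDist τ ρ) (Set.finite_range _).bddAbove ρ

lemma fluct_nonneg (τ : Labeling n K) (H : SimpleGraph (Fin n)) : 0 ≤ fluct a b δ τ H := by
  have h := le_fluct (a := a) (b := b) (δ := δ) τ τ H
  simpa [zdiff] using h

lemma degExcess_nonneg (H : SimpleGraph (Fin n)) : 0 ≤ degExcess a H :=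
  Finset.sum_nonneg fun _ _ => le_max_right _ _

lemma penalty_nonneg (ha : 0 ≤ a) (τ : Labeling n K) (H : SimpleGraph (Fin n)) :
    0 ≤ penalty a b δ τ H :=
  div_nonneg (add_nonneg (fluct_nonneg τ H) (degExcess_nonneg H)) ha

lemma score_le (τ : Labeling n K) {G H : SimpleGraph (Fin n)} {B : Finset (Fin n)}
    (hB : ∀ i j, i ∉ B → j ∉ B → (G.Adj i j ↔ H.Adj i j)) :
    score a b δ G τ ≤ B.card + penalty a b δ τ H :=
  ciInf_le (f := fun q : {q : SimpleGraph (Fin n) × Finset (Fin n) //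
      ∀ i j, i ∉ q.2 → j ∉ q.2 → (G.Adj i j ↔ q.1.Adj i j)} =>
    ((q.1.2.card : ℝ) + penalty a b δ τ q.1.1)) (Set.finite_range _).bddBelow ⟨(H, B), hB⟩

lemma score_le_penalty (τ : Labeling n K) (G : SimpleGraph (Fin n)) :
    score a b δ G τ ≤ penalty a b δ τ G := by
  simpa using score_le (a := a) (b := b) (δ := δ) τ (B := ∅) (fun i j _ _ => Iff.rfl)

lemma exists_score_eq (G : SimpleGraph (Fin n)) (τ : Labeling n K) :
    ∃ (H : SimpleGraph (Fin n)) (B : Finset (Fin n)),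
      (∀ i j, i ∉ B → j ∉ B → (G.Adj i j ↔ H.Adj i j)) ∧
      score a b δ G τ = B.card + penalty a b δ τ H := by
  have : Nonempty {q : SimpleGraph (Fin n) × Finset (Fin n) //
      ∀ i j, i ∉ q.2 → j ∉ q.2 → (G.Adj i j ↔ q.1.Adj i j)} := ⟨⟨(G, ∅), by simp⟩⟩
  obtain ⟨⟨⟨H, B⟩, hB⟩, h⟩ := exists_eq_ciInf_of_finite
    (f := fun q : {q : SimpleGraph (Fin n) × Finset (Fin n) //
      ∀ i j, i ∉ q.2 → j ∉ q.2 → (G.Adj i j ↔ q.1.Adj i j)} =>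
    ((q.1.2.card : ℝ) + penalty a b δ τ q.1.1))
  exact ⟨H, B, hB, h.symm⟩

lemma score_nonneg (ha : 0 ≤ a) (G : SimpleGraph (Fin n)) (τ : Labeling n K) :
    0 ≤ score a b δ G τ := by
  obtain ⟨H, B, -, h⟩ := exists_score_eq (a := a) (b := b) (δ := δ) G τ
  rw [h]
  have := penalty_nonneg (b := b) (δ := δ) ha τ H
  positivity

/-- A surrogate `H` for `G'` with exceptional set `B` also serves `G`, with exceptional set `insert
v B`. -/
lemma score_le_add_one {G G' : SimpleGraph (Fin n)} (h : NodeAdjacent G G')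
    (τ : Labeling n K) : score a b δ G τ ≤ score a b δ G' τ + 1 := by
  obtain ⟨H, B, hB, hs⟩ := exists_score_eq (a := a) (b := b) (δ := δ) G' τ
  obtain ⟨v, hv⟩ := h
  have h1 : score a b δ G τ ≤ (insert v B).card + penalty a b δ τ H := by
    refine score_le τ fun i j hi hj => ?_
    rw [Finset.mem_insert, not_or] at hi hj
    exact (hv i j hi.1 hj.1).trans (hB i j hi.2 hj.2)
  have h2 : ((insert v B).card : ℝ) ≤ B.card + 1 := by exact_mod_cast Finset.card_insert_le v B
  linarith

lemma sum_rdeg_le (H : SimpleGraph (Fin n)) (B : Finset (Fin n)) :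
    ∑ v ∈ B, rdeg H v ≤ 3 * a * B.card + degExcess a H := by
  have h1 : ∑ v ∈ B, rdeg H v ≤ ∑ v ∈ B, (3 * a + max (rdeg H v - 3 * a) 0) :=
    Finset.sum_le_sum fun v _ => by linarith [le_max_left (rdeg H v - 3 * a) 0]
  have h2 : ∑ v ∈ B, max (rdeg H v - 3 * a) 0 ≤ degExcess a H :=
    Finset.sum_le_sum_of_subset_of_nonneg (Finset.subset_univ _) fun _ _ _ => le_max_right _ _
  rw [Finset.sum_add_distrib, Finset.sum_const, nsmul_eq_mul] at h1
  linarith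

lemma sum_pair_incident_le {f : Fin n → Fin n → ℝ} (hs : ∀ i j, f i j = f j i)
    (hf : ∀ i j, 0 ≤ f i j) (h0 : ∀ i, f i i = 0) {B : Finset (Fin n)}
    (hB : ∀ i j, i ∉ B → j ∉ B → f i j = 0) :
    ∑ e : Pair n, f e.1.1 e.1.2 ≤ ∑ v ∈ B, ∑ j, f v j := by
  simp_rw [← sum_pair_incident f hs h0]
  rw [Finset.sum_comm]
  refine Finset.sum_le_sum fun e _ => ?_
  rw [← Finset.sum_mul, Finset.sum_add_distrib, Finset.sum_ite_eq, Finset.sum_ite_eq]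
  have := hf e.1.1 e.1.2
  by_cases h1 : e.1.1 ∈ B
  · rw [if_pos h1]; split_ifs <;> linarith
  · by_cases h2 : e.1.2 ∈ B
    · simp [h1, h2]
    · simp [h1, h2, hB _ _ h1 h2]

/-- Only edges touching `B` change, and their number is controlled by the degrees in `B` for each
graph: `3a` per vertex plus the excess. This is why the penalty includes excess degrees. -/
lemma sum_adjInd_sub_mul_zdiff_le (σ τ : Labeling n K) {H H' : SimpleGraph (Fin n)}
    {B : Finset (Fin n)} (hB : ∀ i j, i ∉ B → j ∉ B → (H.Adj i j ↔ H'.Adj i j)) :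
    ∑ e : Pair n, (adjInd H e.1.1 e.1.2 - adjInd H' e.1.1 e.1.2) * zdiff σ τ e.1.1 e.1.2
      ≤ 6 * a * B.card + degExcess a H + degExcess a H' := by
  have h1 : ∑ e : Pair n, (adjInd H e.1.1 e.1.2 - adjInd H' e.1.1 e.1.2) * zdiff σ τ e.1.1 e.1.2
      ≤ ∑ e : Pair n, |adjInd H e.1.1 e.1.2 - adjInd H' e.1.1 e.1.2| := by
    refine Finset.sum_le_sum fun e _ => (le_abs_self _).trans ?_
    rw [abs_mul]
    exact mul_le_of_le_one_right (abs_nonneg _) (abs_zdiff_le_one σ τ _ _)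
  have h2 := sum_pair_incident_le (f := fun i j => |adjInd H i j - adjInd H' i j|) (B := B)
    (fun i j => by rw [adjInd_comm H, adjInd_comm H']) (fun _ _ => abs_nonneg _)
    (by simp [adjInd]) (fun i j hi hj => by simp [adjInd, hB i j hi hj])
  have h3 : ∑ v ∈ B, ∑ j, |adjInd H v j - adjInd H' v j| ≤ ∑ v ∈ B, (rdeg H v + rdeg H' v) := by
    refine Finset.sum_le_sum fun v _ => ?_
    rw [rdeg, rdeg, ← Finset.sum_add_distrib]
    refine Finset.sum_le_sum fun j _ => ?_
    have := adjInd_nonneg H v j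
    have := adjInd_nonneg H' v j
    rw [abs_le]; constructor <;> linarith
  rw [Finset.sum_add_distrib] at h3
  have h4 := sum_rdeg_le (a := a) H B
  have h5 := sum_rdeg_le (a := a) H' B
  linarith

/-- The constant governing how fast scores separate from each other. -/
def sepConst (K : ℕ) (β ρ : ℝ) : ℝ := (1 - ρ) / (8 * (β * K) ^ 2)

lemma sepConst_pos {β ρ : ℝ} (hK : 2 ≤ K) (hβ : 1 ≤ β) (hρ : ρ < 1) : 0 < sepConst K β ρ := by
  have : (2 : ℝ) ≤ K := by exact_mod_cast hK
  unfold sepConst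
  have : 0 < 1 - ρ := by linarith
  positivity

lemma sepConst_le_one {β ρ : ℝ} (hK : 2 ≤ K) (hβ : 1 ≤ β) (hρ0 : 0 ≤ ρ) :
    sepConst K β ρ ≤ 1 := by
  have hK' : (2 : ℝ) ≤ K := by exact_mod_cast hK
  unfold sepConst
  have : 2 ≤ β * K := by nlinarith
  rw [div_le_one (by positivity)]
  nlinarith

/-- Two labelings cannot both have a small score at the same graph unless they nearly agree up to
relabeling. -/
lemma mul_mismatch_le_score_add_score {β ρ : ℝ} (h : Params n a b) (hK : 2 ≤ K) (hβ : 1 ≤ β)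
    (hρ : b ≤ ρ * a) {σ : Labeling n K} (hσ : σ ∈ balanced n K β)
    (τ : Labeling n K) (G : SimpleGraph (Fin n)) :
    sepConst K β ρ * (n * mismatch σ τ)
      ≤ 3 * (score a b (sepConst K β ρ) G σ + score a b (sepConst K β ρ) G τ) := by
  set δ := sepConst K β ρ with hδ
  have hn := h.cast_pos
  have ha := h.a_pos
  have hK' : (2 : ℝ) ≤ K := by exact_mod_cast hK
  obtain ⟨H, B, hB, hs⟩ := exists_score_eq (a := a) (b := b) (δ := δ) G σ
  obtain ⟨H', B', hB', hs'⟩ := exists_score_eq (a := a) (b := b) (δ := δ) G τ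
  obtain ⟨π, hπ⟩ := exists_mismatch_eq σ τ
  have hm : n * mismatch σ τ = hammingDist σ fun i => π (τ i) := by
    rw [hπ]; field_simp
  have hid := mul_mismatch_le_sum_abs_zdiff σ τ h.n_pos hK hβ hσ
  set m : ℝ := n * mismatch σ τ with hmdef
  set N : ℝ := ∑ e : Pair n, |zdiff σ τ e.1.1 e.1.2| with hN
  have hN0 : 0 ≤ N := Finset.sum_nonneg fun _ _ => abs_nonneg _
  have hm0 : 0 ≤ m := mul_nonneg hn.le (mismatch_nonneg σ τ)
  -- `sepConst` is chosen to give signal `4δam`: the drifts in the two fluctuation terms consume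
  -- `2δam`, and `2δam` remains.
  have hsig : 4 * δ * a * m ≤ (a - b) / n * N := by
    have h1 : 4 * δ * a * m = (1 - ρ) * a / n * (n * m / (2 * (β * K) ^ 2)) := by
      rw [hδ, sepConst]; field_simp; ring
    have h2 : n * m / (2 * (β * K) ^ 2) ≤ N := by
      rw [div_le_iff₀ (by positivity)]; linarith
    have h3 : (1 - ρ) * a / n ≤ (a - b) / n :=
      div_le_div_of_nonneg_right (by linarith) hn.le
    rw [h1]
    have h4 : 0 ≤ (a - b) / n := div_nonneg (by linarith [h.b_lt]) hn.le
    exact mul_le_mul h3 h2 (by positivity) h4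
  have hf := le_fluct (a := a) (b := b) (δ := δ) σ (fun i => π (τ i)) H
  rw [← hm] at hf
  simp_rw [zdiff_perm_right] at hf
  -- The roles are exchanged, with the inverse relabeling so that the Hamming distance is again `m`.
  have hf' := le_fluct (a := a) (b := b) (δ := δ) τ (fun i => π.symm (σ i)) H'
  have hm' : m = hammingDist τ fun i => π.symm (σ i) := by
    rw [hm, ← hammingDist_perm σ (fun i => π (τ i)) π.symm, hammingDist_comm]
    simp
  rw [← hm'] at hf'
  simp_rw [zdiff_perm_right, zdiff_swap σ τ] at hf'
  have hB2 : ∀ i j, i ∉ B ∪ B' → j ∉ B ∪ B' → (H.Adj i j ↔ H'.Adj i j) := by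
    intro i j hi hj
    rw [Finset.mem_union, not_or] at hi hj
    exact (hB i j hi.1 hj.1).symm.trans (hB' i j hi.2 hj.2)
  have hH := sum_adjInd_sub_mul_zdiff_le (a := a) σ τ hB2
  have hcard : ((B ∪ B').card : ℝ) ≤ B.card + B'.card := by
    exact_mod_cast Finset.card_union_le B B'
  have hsplit : (a - b) / n * N
      = ∑ e : Pair n, (edgeProb a b σ e.1.1 e.1.2 - adjInd H e.1.1 e.1.2) * zdiff σ τ e.1.1 e.1.2
        + ∑ e : Pair n, (edgeProb a b τ e.1.1 e.1.2 - adjInd H' e.1.1 e.1.2)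
            * -zdiff σ τ e.1.1 e.1.2
        + ∑ e : Pair n, (adjInd H e.1.1 e.1.2 - adjInd H' e.1.1 e.1.2)
            * zdiff σ τ e.1.1 e.1.2 := by
    rw [hN, Finset.mul_sum, ← Finset.sum_add_distrib, ← Finset.sum_add_distrib]
    refine Finset.sum_congr rfl fun e _ => ?_
    rw [← edgeProb_sub_mul_zdiff]; ring
  have hp : a * penalty a b δ σ H = fluct a b δ σ H + degExcess a H := by
    rw [penalty]; field_simp
  have hp' : a * penalty a b δ τ H' = fluct a b δ τ H' + degExcess a H' := by
    rw [penalty]; field_simp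
  have hp0 := penalty_nonneg (b := b) (δ := δ) ha.le σ H
  have hp0' := penalty_nonneg (b := b) (δ := δ) ha.le τ H'
  -- The surrogates cost `6a` per exceptional vertex, and the fluctuations with the excess degrees
  -- cost `a` times the penalties. Both are covered by six times the scores.
  have hkey : a * (2 * δ * m) ≤ a * (6 * (score a b δ G σ + score a b δ G τ)) := by
    rw [hs, hs']
    have := mul_le_mul_of_nonneg_left hcard ha.le
    nlinarith
  have := le_of_mul_le_mul_left hkey ha
  linarith

end score

/-! ### Upper bound on the risk -/

section upper
variable {n K : ℕ} {a b δ : ℝ}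

lemma graphMean_degExcess_le (h : Params n a b) (σ : Labeling n K) :
    graphMean a b σ (fun G => degExcess a G) ≤ n * Real.exp (-a) := by
  unfold degExcess
  rw [graphMean_sum]
  have h1 : ∀ v : Fin n, graphMean a b σ (fun G => max (rdeg G v - 3 * a) 0)
      ≤ Real.exp (-a) := by
    intro v
    calc graphMean a b σ (fun G => max (rdeg G v - 3 * a) 0)
        ≤ graphMean a b σ (fun G => Real.exp (-(3 * a)) * Real.exp (rdeg G v)) := by
          refine h.graphMean_mono σ fun G => max_le ?_ (by positivity)
          rw [← Real.exp_add]
          linarith [Real.add_one_le_exp (-(3 * a) + rdeg G v)]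
      _ ≤ Real.exp (-(3 * a)) * Real.exp (2 * a) := by
          rw [graphMean_const_mul]
          exact mul_le_mul_of_nonneg_left (graphMean_exp_rdeg_le h σ v) (Real.exp_pos _).le
      _ = Real.exp (-a) := by rw [← Real.exp_add]; congr 1; ring
  refine (Finset.sum_le_sum fun v _ => h1 v).trans (le_of_eq ?_)
  simp

lemma exp_graphMean_le (h : Params n a b) (σ : Labeling n K) (f : SimpleGraph (Fin n) → ℝ) :
    Real.exp (graphMean a b σ f) ≤ graphMean a b σ (fun G => Real.exp (f G)) := by
  have := convexOn_exp.map_sum_le (t := Finset.univ) (w := sbmProb a b σ) (p := f)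
    (fun G _ => h.sbmProb_nonneg σ G) (sum_sbmProb a b σ) (fun _ _ => Set.mem_univ _)
  simpa [graphMean] using this

/-- Tilt by `δ/2`: at Hamming distance `d` the drift contributes `-δ²ad/2` and the fluctuation at
most `δ²ad/4`, leaving a geometric weight in `d`. The supremum is bounded by the sum over labelings,
and Jensen returns to the mean. -/
lemma graphMean_fluct_le (h : Params n a b) (hK : 1 ≤ K) (hδ0 : 0 < δ) (hδ1 : δ ≤ 1)
    (σ : Labeling n K) :
    graphMean a b σ (fun G => fluct a b δ σ G)
      ≤ n * (2 * K / δ * Real.exp (-(δ ^ 2 * a / 4))) := by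
  have key : Real.exp (graphMean a b σ (fun G => δ / 2 * fluct a b δ σ G))
      ≤ Real.exp (n * K * Real.exp (-(δ ^ 2 * a / 4))) := by
    calc _ ≤ graphMean a b σ (fun G => Real.exp (δ / 2 * fluct a b δ σ G)) :=
          exp_graphMean_le h σ _
      _ ≤ graphMean a b σ (fun G => ∑ ρ : Labeling n K,
            Real.exp (-(δ ^ 2 * a / 2 * hammingDist σ ρ)) * Real.exp (δ / 2 * ∑ e : Pair n,
              (edgeProb a b σ e.1.1 e.1.2 - adjInd G e.1.1 e.1.2) * zdiff σ ρ e.1.1 e.1.2)) := by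
          refine h.graphMean_mono σ fun G => ?_
          have : Nonempty (Labeling n K) := ⟨σ⟩
          obtain ⟨ρ, hρ⟩ := exists_eq_ciSup_of_finite (f := fun ρ : Labeling n K =>
            (∑ e : Pair n, (edgeProb a b σ e.1.1 e.1.2 - adjInd G e.1.1 e.1.2)
              * zdiff σ ρ e.1.1 e.1.2 - δ * a * hammingDist σ ρ))
          rw [fluct, ← hρ]
          refine le_trans (le_of_eq ?_) (Finset.single_le_sum
            (f := fun ρ : Labeling n K => Real.exp (-(δ ^ 2 * a / 2 * hammingDist σ ρ))
              * Real.exp (δ / 2 * ∑ e : Pair n,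
              (edgeProb a b σ e.1.1 e.1.2 - adjInd G e.1.1 e.1.2) * zdiff σ ρ e.1.1 e.1.2))
            (fun _ _ => by positivity) (Finset.mem_univ ρ))
          rw [← Real.exp_add]; congr 1; ring
      _ ≤ ∑ ρ : Labeling n K, Real.exp (-(δ ^ 2 * a / 4)) ^ hammingDist σ ρ := by
          rw [graphMean_sum]
          refine Finset.sum_le_sum fun ρ _ => ?_
          rw [graphMean_const_mul]
          refine (mul_le_mul_of_nonneg_left (graphMean_exp_fluctuation_le h σ ρ
            (l := δ / 2) (by linarith) (by linarith)) (Real.exp_pos _).le).trans (le_of_eq ?_)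
          rw [← Real.exp_add, ← Real.exp_nat_mul]; congr 1; ring
      _ ≤ _ := sum_pow_hammingDist_le σ hK (Real.exp_pos _).le
  rw [Real.exp_le_exp, graphMean_const_mul] at key
  have h2 : (n : ℝ) * (2 * K / δ * Real.exp (-(δ ^ 2 * a / 4)))
      = 2 / δ * (n * K * Real.exp (-(δ ^ 2 * a / 4))) := by ring
  rw [h2]
  calc _ = 2 / δ * (δ / 2 * graphMean a b σ (fun G => fluct a b δ σ G)) := by field_simp
    _ ≤ _ := mul_le_mul_of_nonneg_left key (by positivity)

lemma graphMean_score_le (h : Params n a b) (ha : 1 ≤ a) (hK : 1 ≤ K) (hδ0 : 0 < δ)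
    (hδ1 : δ ≤ 1) (σ : Labeling n K) :
    graphMean a b σ (fun G => score a b δ G σ)
      ≤ n * ((2 * K / δ + 1) * Real.exp (-(δ ^ 2 * a / 4))) := by
  have h1 : graphMean a b σ (fun G => score a b δ G σ)
      ≤ graphMean a b σ (fun G => fluct a b δ σ G) + graphMean a b σ (fun G => degExcess a G) := by
    rw [← graphMean_add]
    refine h.graphMean_mono σ fun G => (score_le_penalty σ G).trans ?_
    exact div_le_self (add_nonneg (fluct_nonneg σ G) (degExcess_nonneg G)) ha
  have h2 := graphMean_fluct_le h hK hδ0 hδ1 σ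
  have h3 := graphMean_degExcess_le h σ
  have h4 : Real.exp (-a) ≤ Real.exp (-(δ ^ 2 * a / 4)) := by
    have hd : δ ^ 2 ≤ 1 := pow_le_one₀ hδ0.le hδ1
    rw [Real.exp_le_exp]; nlinarith
  have h5 := mul_le_mul_of_nonneg_left h4 h.cast_pos.le
  linarith

/-- Bound each labeling by the sum over all its relabelings, then apply the Hamming generating
function. Excluding exact recovery removes the term 1. -/
lemma sum_exp_mismatch_le (σ : Labeling n K) (hK : 1 ≤ K) (t : ℝ) :
    ∑ τ : Labeling n K, (if 0 < mismatch σ τ then Real.exp (-(t * (n * mismatch σ τ))) else 0)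
      ≤ K.factorial * (Real.exp (n * K * Real.exp (-t)) - 1) := by
  have h1 : ∀ τ : Labeling n K,
      (if 0 < mismatch σ τ then Real.exp (-(t * (n * mismatch σ τ))) else 0)
      ≤ ∑ π : Equiv.Perm (Fin K), if (fun i => π (τ i)) = σ then 0
          else Real.exp (-t) ^ hammingDist σ (fun i => π (τ i)) := by
    intro τ
    have hnn : ∀ π ∈ (Finset.univ : Finset (Equiv.Perm (Fin K))),
        0 ≤ (if (fun i => π (τ i)) = σ then 0
          else Real.exp (-t) ^ hammingDist σ (fun i => π (τ i))) := fun π _ => by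
      split_ifs <;> positivity
    split_ifs with h
    · obtain ⟨π, hπ⟩ := exists_mismatch_eq σ τ
      refine le_trans (le_of_eq ?_) (Finset.single_le_sum hnn (Finset.mem_univ π))
      have hne : (fun i => π (τ i)) ≠ σ := by
        intro he
        rw [hπ, he] at h
        simp at h
      have hn : (n : ℝ) ≠ 0 := by
        rintro hn
        rw [hπ, hn] at h
        simp at h
      rw [if_neg hne, hπ, ← Real.exp_nat_mul]
      congr 1
      field_simp
    · exact Finset.sum_nonneg hnn
  refine (Finset.sum_le_sum fun τ _ => h1 τ).trans ?_
  rw [Finset.sum_comm]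
  have h2 : ∀ π : Equiv.Perm (Fin K), ∑ τ : Labeling n K, (if (fun i => π (τ i)) = σ then 0
          else Real.exp (-t) ^ hammingDist σ (fun i => π (τ i)))
      ≤ Real.exp (n * K * Real.exp (-t)) - 1 := by
    intro π
    have h3 : ∑ τ : Labeling n K, (if (fun i => π (τ i)) = σ then 0
          else Real.exp (-t) ^ hammingDist σ (fun i => π (τ i)))
        = ∑ τ : Labeling n K, (if τ = σ then 0 else Real.exp (-t) ^ hammingDist σ τ) :=
      Fintype.sum_equiv (Equiv.arrowCongr (Equiv.refl (Fin n)) π) _ _ fun τ => rfl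
    have h4 : ∀ τ : Labeling n K, (if τ = σ then 0 else Real.exp (-t) ^ hammingDist σ τ)
        = Real.exp (-t) ^ hammingDist σ τ - if τ = σ then 1 else 0 := by
      intro τ
      split_ifs with h
      · simp [h]
      · simp
    rw [h3]
    simp_rw [h4]
    rw [Finset.sum_sub_distrib, Finset.sum_ite_eq' Finset.univ σ, if_pos (Finset.mem_univ _)]
    linarith [sum_pow_hammingDist_le σ hK (Real.exp_pos (-t)).le]
  refine (Finset.sum_le_sum fun π _ => h2 π).trans (le_of_eq ?_)
  simp [Fintype.card_perm, mul_sub]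

lemma expectedMismatch_eq (a b : ℝ) (σ : Labeling n K) (M : Mechanism n K) :
    expectedMismatch a b σ M
      = graphMean a b σ (fun G => ∑ τ : Labeling n K, (M G τ).toReal * mismatch σ τ) := rfl

lemma expectedMismatch_nonneg (h : Params n a b) (σ : Labeling n K) (M : Mechanism n K) :
    0 ≤ expectedMismatch a b σ M := by
  rw [expectedMismatch_eq]
  exact Finset.sum_nonneg fun G _ => mul_nonneg (h.sbmProb_nonneg σ G)
    (Finset.sum_nonneg fun τ _ => mul_nonneg ENNReal.toReal_nonneg (mismatch_nonneg σ τ))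

lemma expectedMismatch_expMechanism_le [Nonempty (Labeling n K)] {β ρ ε : ℝ} (h : Params n a b)
    (ha : 1 ≤ a) (hK : 2 ≤ K)
    (hβ : 1 ≤ β) (hρ0 : 0 ≤ ρ) (hρ1 : ρ < 1) (hρ : b ≤ ρ * a) (hε : 0 ≤ ε)
    {σ : Labeling n K} (hσ : σ ∈ balanced n K β) (hδ : δ = sepConst K β ρ) :
    expectedMismatch a b σ (expMechanism ε (score a b δ))
      ≤ 12 / δ * (2 * K / δ + 1) * Real.exp (-(δ ^ 2 * a / 4))
        + K.factorial * (Real.exp (n * K * Real.exp (-(δ * ε / 12))) - 1) := by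
  have hn := h.cast_pos
  have hδ0 : 0 < δ := hδ ▸ sepConst_pos hK hβ hρ1
  have hδ1 : δ ≤ 1 := hδ ▸ sepConst_le_one hK hβ hρ0
  rw [expectedMismatch_eq]
  have hpt : ∀ G : SimpleGraph (Fin n), ∑ τ : Labeling n K,
      (expMechanism ε (score a b δ) G τ).toReal * mismatch σ τ
      ≤ (12 / (δ * n)) * score a b δ G σ + K.factorial
        * (Real.exp (n * K * Real.exp (-(δ * ε / 12))) - 1) := by
    intro G
    have hS := score_nonneg (b := b) (δ := δ) h.a_pos.le G σ
    set S := score a b δ G σ with hSdef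
    have hterm : ∀ τ : Labeling n K, (expMechanism ε (score a b δ) G τ).toReal * mismatch σ τ
        ≤ gibbs ε (score a b δ G) τ * ((12 / (δ * n)) * S)
          + (if 0 < mismatch σ τ then Real.exp (-(δ * ε / 12 * (n * mismatch σ τ))) else 0) := by
      intro τ
      rw [expMechanism_toReal]
      have hg := gibbs_nonneg (ε := ε) (score a b δ G) τ
      have hm0 := mismatch_nonneg σ τ
      have hm1 := mismatch_le_one σ τ
      -- The first case charges the loss to the true score `S`. In the other, `12S < δ n * mismatch`
      -- and the separation bound give a score gap of at least `δ n * mismatch / 6`, hence a tiny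
      -- Gibbs weight.
      by_cases hc : mismatch σ τ ≤ (12 / (δ * n)) * S
      · have : 0 ≤ (if 0 < mismatch σ τ then
            Real.exp (-(δ * ε / 12 * (n * mismatch σ τ))) else 0) := by
          split_ifs <;> positivity
        have := mul_le_mul_of_nonneg_left hc hg
        linarith
      · push Not at hc
        have hpos : 0 < mismatch σ τ := lt_of_le_of_lt (by positivity) hc
        rw [if_pos hpos]
        have hsep := mul_mismatch_le_score_add_score h hK hβ hρ hσ τ G
        rw [← hδ, ← hSdef] at hsep
        have hc' : 12 * S < δ * (n * mismatch σ τ) := by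
          rw [div_mul_eq_mul_div, div_lt_iff₀ (by positivity)] at hc
          linarith
        have h1 : gibbs ε (score a b δ G) τ ≤ Real.exp (-(δ * ε / 12 * (n * mismatch σ τ))) := by
          refine (gibbs_le (score a b δ G) σ τ).trans (Real.exp_le_exp.2 ?_)
          rw [← hSdef]
          have h2 : δ * (n * mismatch σ τ) / 6 ≤ score a b δ G τ - S := by linarith
          nlinarith [mul_le_mul_of_nonneg_left h2 hε]
        have h2 : 0 ≤ gibbs ε (score a b δ G) τ * ((12 / (δ * n)) * S) := by positivity
        nlinarith
    refine (Finset.sum_le_sum fun τ _ => hterm τ).trans ?_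
    rw [Finset.sum_add_distrib, ← Finset.sum_mul, sum_gibbs, one_mul]
    linarith [sum_exp_mismatch_le σ (by omega : 1 ≤ K) (δ * ε / 12)]
  refine (h.graphMean_mono σ hpt).trans ?_
  rw [graphMean_add, graphMean_const_mul, graphMean_const]
  have hsc := graphMean_score_le h ha (by omega : 1 ≤ K) hδ0 hδ1 σ
  have h3 := mul_le_mul_of_nonneg_left hsc (by positivity : 0 ≤ 12 / (δ * n))
  have h4 : 12 / (δ * n) * (n * ((2 * K / δ + 1) * Real.exp (-(δ ^ 2 * a / 4))))
      = 12 / δ * (2 * K / δ + 1) * Real.exp (-(δ ^ 2 * a / 4)) := by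
    field_simp
  rw [h4] at h3
  linarith

theorem minimaxRisk_le {β ρ ε : ℝ} (h : Params n a b) (ha : 1 ≤ a) (hK : 2 ≤ K)
    (hβ : 1 ≤ β) (hρ0 : 0 ≤ ρ) (hρ1 : ρ < 1) (hρ : b ≤ ρ * a) (hε : 0 ≤ ε)
    (hne : (balanced n K β).Nonempty) (hδ : δ = sepConst K β ρ) :
    minimaxRisk ε n K a b β
      ≤ 12 / δ * (2 * K / δ + 1) * Real.exp (-(δ ^ 2 * a / 4))
        + K.factorial * (Real.exp (n * K * Real.exp (-(δ * ε / 12))) - 1) := by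
  have : Nonempty (Labeling n K) := ⟨hne.some⟩
  have : Nonempty (balanced n K β) := hne.to_subtype
  have hdp : IsNodeDP ε (expMechanism ε (score (K := K) a b δ) : Mechanism n K) :=
    isNodeDP_expMechanism hε _ fun G G' hG τ => score_le_add_one hG τ
  refine (ciInf_le ?_ (⟨expMechanism ε (score a b δ), hdp⟩ :
    {M : Mechanism n K // IsNodeDP ε M})).trans (ciSup_le fun σ => ?_)
  · exact ⟨0, by
      rintro _ ⟨M, rfl⟩
      exact Real.iSup_nonneg fun σ => expectedMismatch_nonneg h σ.1 M.1⟩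
  · exact expectedMismatch_expMechanism_le h ha hK hβ hρ0 hρ1 hρ hε σ.2 hδ

end upper

/-! ### Comparing models whose labelings differ at two vertices -/

section comparison
variable {n K : ℕ} {a b : ℝ}

lemma edgeProb_congr {σ σ' : Labeling n K} {i j : Fin n} (hi : σ i = σ' i) (hj : σ j = σ' j) :
    edgeProb a b σ i j = edgeProb a b σ' i j := by simp [edgeProb, hi, hj]

lemma exp_neg_two_mul_le {x : ℝ} (h0 : 0 ≤ x) (h1 : x ≤ 1 / 2) :
    Real.exp (-(2 * x)) ≤ 1 - x := by
  rw [Real.exp_neg]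
  refine inv_le_of_inv_le₀ (by linarith) ?_
  have h2 : (1 - x)⁻¹ ≤ 2 * x + 1 := by
    rw [inv_le_iff_one_le_mul₀ (by linarith)]; nlinarith
  exact h2.trans (Real.add_one_le_exp _)

/-- Likelihoods of block models whose labelings differ in two vertices of moderate degree are
comparable. -/
lemma exp_mul_sbmProb_le (h : Params n a b) {ρ : ℝ} (hρ0 : 0 < ρ) (hρ1 : ρ ≤ 1)
    (hρ : ρ * a ≤ b) {σ σ' : Labeling n K} {v w : Fin n}
    (hσ : ∀ i, i ≠ v → i ≠ w → σ i = σ' i) {G : SimpleGraph (Fin n)}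
    (hv : rdeg G v ≤ 3 * a) (hw : rdeg G w ≤ 3 * a) :
    Real.exp (-((6 * -Real.log ρ + 4) * a)) * sbmProb a b σ G ≤ sbmProb a b σ' G := by
  have hn := h.cast_pos
  have ha := h.a_pos
  have hl : 0 ≤ -Real.log ρ := by linarith [Real.log_nonpos hρ0.le hρ1]
  set l := -Real.log ρ with hldef
  -- Every off-diagonal pair is charged `2a/n`, covering the non-edge factor `1 - a/n`, and an edge
  -- is charged `l` more, covering the factor `ρ`. A vertex of degree at most `3a` then pays at most
  -- `(3l + 2)a`.
  set g : Fin n → Fin n → ℝ := fun i j => l * adjInd G i j + if i = j then 0 else 2 * (a / n)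
    with hg
  have hg0 : ∀ i j, 0 ≤ g i j := fun i j =>
    add_nonneg (mul_nonneg hl (adjInd_nonneg G i j)) (by split_ifs <;> positivity)
  set inc : Fin n → Pair n → ℝ := fun u e =>
    (if e.1.1 = u then 1 else 0) + (if e.1.2 = u then 1 else 0) with hinc
  have hgsum : ∀ u, rdeg G u ≤ 3 * a → ∑ e, inc u e * g e.1.1 e.1.2 ≤ (3 * l + 2) * a := by
    intro u hu
    rw [sum_pair_incident g (fun i j => by simp [hg, adjInd_comm G i j, eq_comm])
      (fun i => by simp [hg, adjInd]) u]
    simp only [hg]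
    rw [Finset.sum_add_distrib, ← Finset.mul_sum]
    have h1 : ∑ j, (if u = j then (0 : ℝ) else 2 * (a / n)) ≤ ∑ _j : Fin n, 2 * (a / n) := by
      refine Finset.sum_le_sum fun j _ => ?_
      split_ifs
      · positivity
      · exact le_rfl
    have h2 : ∑ _j : Fin n, 2 * (a / n) = 2 * a := by simp; field_simp
    have h3 := mul_le_mul_of_nonneg_left hu hl
    rw [rdeg] at h3
    linarith
  have hexp : Real.exp (-((6 * l + 4) * a))
      ≤ ∏ e : Pair n, Real.exp (-((inc v e + inc w e) * g e.1.1 e.1.2)) := by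
    rw [← Real.exp_sum, Real.exp_le_exp, Finset.sum_neg_distrib]
    simp_rw [add_mul, Finset.sum_add_distrib]
    linarith [hgsum v hv, hgsum w hw]
  refine (mul_le_mul_of_nonneg_right hexp (h.sbmProb_nonneg σ G)).trans ?_
  rw [sbmProb_eq_prod_pair, sbmProb_eq_prod_pair, ← Finset.prod_mul_distrib]
  refine Finset.prod_le_prod (fun e _ => ?_) fun e _ => ?_
  · have := h.edgeProb_nonneg σ e.1.1 e.1.2
    have := h.edgeProb_le_half σ e.1.1 e.1.2
    refine mul_nonneg (Real.exp_pos _).le ?_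
    split_ifs <;> linarith
  · by_cases hc : (e.1.1 ≠ v ∧ e.1.1 ≠ w) ∧ (e.1.2 ≠ v ∧ e.1.2 ≠ w)
    · obtain ⟨⟨h1, h2⟩, h3, h4⟩ := hc
      rw [edgeProb_congr (hσ _ h1 h2) (hσ _ h3 h4)]
      simp [hinc, h1, h2, h3, h4]
    · have hge : 1 ≤ inc v e + inc w e := by
        have hite : ∀ (p : Prop) [Decidable p], (0 : ℝ) ≤ if p then 1 else 0 := fun p _ => by
          split_ifs <;> norm_num
        have i1 := hite (e.1.1 = v)
        have i2 := hite (e.1.2 = v)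
        have i3 := hite (e.1.1 = w)
        have i4 := hite (e.1.2 = w)
        simp only [hinc]
        by_cases h1 : e.1.1 = v
        · rw [if_pos h1] at i1 ⊢; linarith
        by_cases h2 : e.1.2 = v
        · rw [if_pos h2] at i2 ⊢; linarith
        by_cases h3 : e.1.1 = w
        · rw [if_pos h3] at i3 ⊢; linarith
        by_cases h4 : e.1.2 = w
        · rw [if_pos h4] at i4 ⊢; linarith
        exact absurd ⟨⟨h1, h3⟩, h2, h4⟩ hc
      have he : e.1.1 ≠ e.1.2 := e.2.ne
      have hr : Real.exp (-((inc v e + inc w e) * g e.1.1 e.1.2)) ≤ Real.exp (-g e.1.1 e.1.2) := by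
        rw [Real.exp_le_exp]; nlinarith [hg0 e.1.1 e.1.2]
      have hp0 := h.edgeProb_nonneg σ e.1.1 e.1.2
      have hp1 := h.edgeProb_le σ e.1.1 e.1.2
      have hp2 := h.edgeProb_le_half σ e.1.1 e.1.2
      have hp' := h.edgeProb_le σ' e.1.1 e.1.2
      split_ifs with hadj
      · refine (mul_le_mul_of_nonneg_right hr hp0).trans ?_
        have h1 : Real.exp (-g e.1.1 e.1.2) ≤ ρ := by
          have : Real.exp (-l) = ρ := by rw [hldef, neg_neg, Real.exp_log hρ0]
          rw [← this, Real.exp_le_exp]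
          simp only [hg, adjInd, if_pos hadj, if_neg he]
          have : 0 ≤ a / n := by positivity
          linarith
        have h2 : ρ * (a / n) ≤ edgeProb a b σ' e.1.1 e.1.2 := by
          unfold edgeProb
          split_ifs
          · have : 0 ≤ a / n := by positivity
            nlinarith
          · rw [← mul_div_assoc]; exact div_le_div_of_nonneg_right hρ hn.le
        exact (mul_le_mul h1 hp1 hp0 hρ0.le).trans h2
      · refine (mul_le_mul_of_nonneg_right hr (by linarith)).trans ?_
        have h1 : Real.exp (-g e.1.1 e.1.2) ≤ 1 - a / n := by
          simp only [hg, adjInd, if_neg hadj, if_neg he, mul_zero, zero_add]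
          exact exp_neg_two_mul_le (by positivity) h.div_le
        have h2 := Real.exp_pos (-g e.1.1 e.1.2)
        nlinarith

/-- Replace the edges of `G` that touch `J` by those of `H`. -/
def mixGraph (J : Finset (Fin n)) (G H : SimpleGraph (Fin n)) : SimpleGraph (Fin n) where
  Adj i j := if i ∈ J ∨ j ∈ J then H.Adj i j else G.Adj i j
  symm := ⟨fun i j h => by
    simp only [or_comm (a := j ∈ J) (b := i ∈ J)]
    split_ifs at h ⊢
    exacts [h.symm, h.symm]⟩
  loopless := ⟨fun i => by simp⟩

lemma mixGraph_adj (J : Finset (Fin n)) (G H : SimpleGraph (Fin n)) (i j : Fin n) :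
    (mixGraph J G H).Adj i j ↔ if i ∈ J ∨ j ∈ J then H.Adj i j else G.Adj i j := Iff.rfl

lemma mixGraph_mixGraph (J : Finset (Fin n)) (G H : SimpleGraph (Fin n)) :
    mixGraph J (mixGraph J G H) (mixGraph J H G) = G := by
  ext i j
  simp only [mixGraph_adj]
  split_ifs <;> rfl

/-- Away from `J` the two models have the same edge probabilities, so exchanging the edges at `J`
between independent samples exchanges their laws. -/
lemma sbmProb_mul_sbmProb_mixGraph {J : Finset (Fin n)} {σ σ' : Labeling n K}
    (hσ : ∀ i, i ∉ J → σ i = σ' i) (G H : SimpleGraph (Fin n)) :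
    sbmProb a b σ (mixGraph J G H) * sbmProb a b σ' (mixGraph J H G)
      = sbmProb a b σ' G * sbmProb a b σ H := by
  simp only [sbmProb_eq_prod_pair, ← Finset.prod_mul_distrib]
  refine Finset.prod_congr rfl fun e _ => ?_
  simp only [mixGraph_adj]
  by_cases h : e.1.1 ∈ J ∨ e.1.2 ∈ J
  · simp only [h, if_true]; ring
  · simp only [h, if_false]
    rw [not_or] at h
    rw [edgeProb_congr (hσ _ h.1) (hσ _ h.2)]

/-- Resampling the edges at `J` changes the mean of a functional that is stable under such
changes by a bounded factor only. -/
lemma graphMean_le_mul_graphMean (h : Params n a b) {J : Finset (Fin n)} {σ σ' : Labeling n K}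
    (hσ : ∀ i, i ∉ J → σ i = σ' i) {C : ℝ} {f : SimpleGraph (Fin n) → ℝ}
    (hf : ∀ G H, f (mixGraph J G H) ≤ C * f G) :
    graphMean a b σ f ≤ C * graphMean a b σ' f := by
  -- The exchange of the edges at `J` is an involution on pairs of graphs, used as a
  -- measure-preserving coupling of the two models.
  let Φ : Equiv.Perm (SimpleGraph (Fin n) × SimpleGraph (Fin n)) :=
    Function.Involutive.toPerm (fun p => (mixGraph J p.1 p.2, mixGraph J p.2 p.1)) fun p => by
      simp [mixGraph_mixGraph]
  have hext : ∀ (τ τ' : Labeling n K) (F : SimpleGraph (Fin n) → ℝ), graphMean a b τ F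
      = ∑ p : SimpleGraph (Fin n) × SimpleGraph (Fin n),
        sbmProb a b τ p.1 * sbmProb a b τ' p.2 * F p.1 := by
    intro τ τ' F
    rw [Fintype.sum_prod_type]
    refine Finset.sum_congr rfl fun G _ => ?_
    simp only
    rw [← Finset.sum_mul, ← Finset.mul_sum, sum_sbmProb, mul_one]
  rw [hext σ σ' f, hext σ' σ f, ← Equiv.sum_comp Φ, Finset.mul_sum]
  refine Finset.sum_le_sum fun p _ => ?_
  have h1 : sbmProb a b σ (Φ p).1 * sbmProb a b σ' (Φ p).2
      = sbmProb a b σ' p.1 * sbmProb a b σ p.2 := sbmProb_mul_sbmProb_mixGraph hσ p.1 p.2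
  rw [h1]
  have h2 := mul_nonneg (h.sbmProb_nonneg σ' p.1) (h.sbmProb_nonneg σ p.2)
  have h3 := mul_le_mul_of_nonneg_left (hf p.1 p.2) h2
  calc _ ≤ _ := h3
    _ = _ := by ring

/-- The expectation of `g` under the output law of the mechanism at `G`. -/
def outMean (M : Mechanism n K) (g : Labeling n K → ℝ) (G : SimpleGraph (Fin n)) : ℝ :=
  ∑ τ, (M G τ).toReal * g τ

lemma sum_toReal_apply (M : Mechanism n K) (G : SimpleGraph (Fin n)) :
    ∑ τ, (M G τ).toReal = 1 := by
  rw [← ENNReal.toReal_sum fun τ _ => PMF.apply_ne_top _ _]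
  have := (M G).tsum_coe
  rw [tsum_fintype] at this
  rw [this, ENNReal.toReal_one]

lemma outMean_nonneg (M : Mechanism n K) {g : Labeling n K → ℝ} (hg : ∀ τ, 0 ≤ g τ)
    (G : SimpleGraph (Fin n)) : 0 ≤ outMean M g G :=
  Finset.sum_nonneg fun τ _ => mul_nonneg ENNReal.toReal_nonneg (hg τ)

lemma outMean_le_one (M : Mechanism n K) {g : Labeling n K → ℝ} (hg : ∀ τ, g τ ≤ 1)
    (G : SimpleGraph (Fin n)) : outMean M g G ≤ 1 := by
  rw [← sum_toReal_apply M G]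
  exact Finset.sum_le_sum fun τ _ => mul_le_of_le_one_right ENNReal.toReal_nonneg (hg τ)

lemma IsNodeDP.outMean_le {ε : ℝ} {M : Mechanism n K} (hM : IsNodeDP ε M)
    {g : Labeling n K → ℝ} (hg : ∀ τ, 0 ≤ g τ) {G G' : SimpleGraph (Fin n)}
    (hG : NodeAdjacent G G') : outMean M g G ≤ Real.exp ε * outMean M g G' := by
  unfold outMean
  rw [Finset.mul_sum]
  refine Finset.sum_le_sum fun τ _ => ?_
  rw [← mul_assoc]
  refine mul_le_mul_of_nonneg_right ?_ (hg τ)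
  have h1 := hM G G' hG {τ}
  rw [PMF.toOuterMeasure_apply_singleton, PMF.toOuterMeasure_apply_singleton] at h1
  have h2 := ENNReal.toReal_mono (ENNReal.mul_ne_top ENNReal.ofReal_ne_top
    (PMF.apply_ne_top _ _)) h1
  rwa [ENNReal.toReal_mul, ENNReal.toReal_ofReal (Real.exp_pos _).le] at h2

/-- Rewiring at `v` and then at `w` is two node-adjacent steps, each costing a factor `exp ε`. -/
lemma IsNodeDP.graphMean_outMean_le (h : Params n a b) {ε : ℝ} {M : Mechanism n K}
    (hM : IsNodeDP ε M) {σ σ' : Labeling n K} {v w : Fin n}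
    (hσ : ∀ i, i ≠ v → i ≠ w → σ i = σ' i) {g : Labeling n K → ℝ} (hg : ∀ τ, 0 ≤ g τ) :
    Real.exp (-(2 * ε)) * graphMean a b σ (outMean M g) ≤ graphMean a b σ' (outMean M g) := by
  have h1 := graphMean_le_mul_graphMean h (J := {v, w}) (σ := σ) (σ' := σ')
    (C := Real.exp ε * Real.exp ε) (f := outMean M g)
    (fun i hi => by
      rw [Finset.mem_insert, Finset.mem_singleton, not_or] at hi
      exact hσ i hi.1 hi.2)
    (fun G H => by
      have e1 : NodeAdjacent (mixGraph {v, w} G H) (mixGraph {v} G H) :=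
        ⟨w, fun i j hi hj => by simp [mixGraph_adj, hi, hj]⟩
      have e2 : NodeAdjacent (mixGraph {v} G H) G :=
        ⟨v, fun i j hi hj => by simp [mixGraph_adj, hi, hj]⟩
      rw [mul_assoc]
      exact (hM.outMean_le hg e1).trans
        (mul_le_mul_of_nonneg_left (hM.outMean_le hg e2) (Real.exp_pos _).le))
  refine (mul_le_mul_of_nonneg_left h1 (Real.exp_pos _).le).trans (le_of_eq ?_)
  rw [← mul_assoc, ← Real.exp_add, ← Real.exp_add]
  have : -(2 * ε) + (ε + ε) = 0 := by ring
  rw [this, Real.exp_zero, one_mul]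

/-- When both degrees are at most `3a`, the likelihood ratio is bounded below. Otherwise `f` is
dominated by exponentials of the degrees, of total mean at most `2 exp(-a) ≤ 1/2`; this is the `1/2`
lost. -/
lemma graphMean_comparison (h : Params n a b) (ha : 2 ≤ a) {ρ : ℝ} (hρ0 : 0 < ρ) (hρ1 : ρ ≤ 1)
    (hρ : ρ * a ≤ b) {σ σ' : Labeling n K} {v w : Fin n}
    (hσ : ∀ i, i ≠ v → i ≠ w → σ i = σ' i) {f : SimpleGraph (Fin n) → ℝ}
    (hf0 : ∀ G, 0 ≤ f G) (hf1 : ∀ G, f G ≤ 1) :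
    Real.exp (-((6 * -Real.log ρ + 4) * a)) * (graphMean a b σ f - 1 / 2)
      ≤ graphMean a b σ' f := by
  set κ := Real.exp (-((6 * -Real.log ρ + 4) * a)) with hκ
  have hκ0 : 0 < κ := Real.exp_pos _
  have hpt : ∀ G, κ * (sbmProb a b σ G * f G)
      ≤ sbmProb a b σ' G * f G + κ * (sbmProb a b σ G *
        (Real.exp (-(3 * a)) * (Real.exp (rdeg G v) + Real.exp (rdeg G w)))) := by
    intro G
    have hs := h.sbmProb_nonneg σ G
    have hs' := h.sbmProb_nonneg σ' G
    have hf0' := hf0 G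
    by_cases hF : rdeg G v ≤ 3 * a ∧ rdeg G w ≤ 3 * a
    · have h1 := exp_mul_sbmProb_le h hρ0 hρ1 hρ hσ hF.1 hF.2
      have h2 := mul_le_mul_of_nonneg_right h1 hf0'
      have h3 : 0 ≤ κ * (sbmProb a b σ G *
        (Real.exp (-(3 * a)) * (Real.exp (rdeg G v) + Real.exp (rdeg G w)))) := by positivity
      rw [← mul_assoc]
      linarith
    · have h1 : 1 ≤ Real.exp (-(3 * a)) * (Real.exp (rdeg G v) + Real.exp (rdeg G w)) := by
        rw [mul_add, ← Real.exp_add, ← Real.exp_add]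
        rw [not_and_or] at hF
        rcases hF with hF | hF
        · have := Real.one_le_exp (by linarith : 0 ≤ -(3 * a) + rdeg G v)
          linarith [Real.exp_pos (-(3 * a) + rdeg G w)]
        · have := Real.one_le_exp (by linarith : 0 ≤ -(3 * a) + rdeg G w)
          linarith [Real.exp_pos (-(3 * a) + rdeg G v)]
      have h2 := mul_le_mul_of_nonneg_left ((hf1 G).trans h1) hs
      have h3 := mul_le_mul_of_nonneg_left h2 hκ0.le
      have h4 := mul_nonneg hs' hf0'
      linarith
  have hsum := Finset.sum_le_sum fun G (_ : G ∈ Finset.univ) => hpt G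
  rw [Finset.sum_add_distrib, ← Finset.mul_sum, ← Finset.mul_sum] at hsum
  change κ * graphMean a b σ f ≤ graphMean a b σ' f + κ * graphMean a b σ (fun G =>
    Real.exp (-(3 * a)) * (Real.exp (rdeg G v) + Real.exp (rdeg G w))) at hsum
  rw [graphMean_const_mul, graphMean_add] at hsum
  have h1 := graphMean_exp_rdeg_le h σ v
  have h2 := graphMean_exp_rdeg_le h σ w
  have h3 : Real.exp (-(3 * a)) * Real.exp (2 * a) ≤ 1 / 4 := by
    rw [← Real.exp_add]
    have e1 : Real.exp (-(3 * a) + 2 * a) ≤ Real.exp (-2) := Real.exp_le_exp.2 (by linarith)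
    have e2 : Real.exp (-2) ≤ 1 / 4 := by
      have e3 : Real.exp (-2) = (Real.exp 1 * Real.exp 1)⁻¹ := by
        rw [← Real.exp_add, ← Real.exp_neg]; norm_num
      rw [e3, one_div]
      have e4 := Real.add_one_le_exp (1 : ℝ)
      exact inv_anti₀ (by norm_num) (by nlinarith)
    exact e1.trans e2
  have h4 : Real.exp (-(3 * a)) * (graphMean a b σ (fun G => Real.exp (rdeg G v))
      + graphMean a b σ (fun G => Real.exp (rdeg G w))) ≤ 1 / 2 := by
    have := mul_le_mul_of_nonneg_left (add_le_add h1 h2) (Real.exp_pos (-(3 * a))).le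
    linarith
  have h5 := mul_le_mul_of_nonneg_left h4 hκ0.le
  linarith

end comparison

/-! ### Assouad's method on disjoint transpositions -/

/-- A labeling together with a family `I` of disjoint transpositions `v ↔ s v`, each exchanging a
vertex of the class `k₀` with one of the class `k₁`, such that every class is large. -/
structure SwapSystem (n K : ℕ) where
  σ : Labeling n K
  s : Fin n → Fin n
  I : Finset (Fin n)
  k₀ : Fin K
  k₁ : Fin K
  ne : k₀ ≠ k₁
  invol : ∀ v, s (s v) = v
  label : ∀ v ∈ I, σ v = k₀
  label_swap : ∀ v ∈ I, σ (s v) = k₁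
  large : ∀ k, 3 * I.card ≤ (Finset.univ.filter fun i => σ i = k).card

namespace SwapSystem
variable {n K : ℕ} (S : SwapSystem n K)

/-- The labeling in which the transpositions indexed by `U` have been performed. -/
def lab (U : Finset (Fin n)) : Labeling n K := fun v =>
  S.σ (if v ∈ U ∩ S.I ∨ S.s v ∈ U ∩ S.I then S.s v else v)

lemma swap_notMem {v : Fin n} (hv : v ∈ S.I) : S.s v ∉ S.I := fun h =>
  S.ne ((S.label _ h).symm.trans (S.label_swap v hv))

lemma lab_mem {v : Fin n} (hv : v ∈ S.I) (U : Finset (Fin n)) :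
    S.lab U v = if v ∈ U then S.k₁ else S.k₀ := by
  have h := S.swap_notMem hv
  by_cases hU : v ∈ U <;> simp [lab, hv, h, hU, S.label, S.label_swap]

lemma lab_notMem {v : Fin n} (hv : v ∉ S.I) (hv' : S.s v ∉ S.I) (U : Finset (Fin n)) :
    S.lab U v = S.σ v := by
  simp [lab, hv, hv']

lemma lab_symmDiff_singleton {v i : Fin n} (U : Finset (Fin n)) (h1 : i ≠ v) (h2 : i ≠ S.s v) :
    S.lab U i = S.lab (symmDiff U {v}) i := by
  have h3 : S.s i ≠ v := fun h => h2 (by rw [← h, S.invol])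
  simp [lab, Finset.mem_symmDiff, h1, h3]

/-- Performing the transpositions permutes the vertices, so class sizes are preserved exactly; this
matters even for `β = 1`. -/
lemma lab_mem_balanced {β : ℝ} (h : S.σ ∈ balanced n K β) (U : Finset (Fin n)) :
    S.lab U ∈ balanced n K β := by
  let φ : Equiv.Perm (Fin n) := Function.Involutive.toPerm
    (fun v => if v ∈ U ∩ S.I ∨ S.s v ∈ U ∩ S.I then S.s v else v) (fun v => by
      by_cases hv : v ∈ U ∩ S.I ∨ S.s v ∈ U ∩ S.I
      · simp only [if_pos hv, S.invol, if_pos hv.symm]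
      · simp only [if_neg hv])
  intro k
  have hcard : (Finset.univ.filter fun i => S.lab U i = k).card
      = (Finset.univ.filter fun i => S.σ i = k).card :=
    Finset.card_equiv φ fun i => by
      simp only [Finset.mem_filter, Finset.mem_univ, true_and]
      rfl
  rw [hcard]
  exact h k

/-- The number of transpositions on which `U` and `V` differ. -/
def dist (U V : Finset (Fin n)) : ℕ := (S.I.filter fun v => ¬(v ∈ U ↔ v ∈ V)).card

/-- Under the identity relabeling every differing transposition gives an error. Any other relabeling
moves some class, which has at least `3|I| - 2|I| = |I|` vertices outside the transpositions, all of
them errors. -/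
lemma dist_le_mul_mismatch (hn : 0 < n) (U V : Finset (Fin n)) :
    (S.dist U V : ℝ) ≤ n * mismatch (S.lab U) (S.lab V) := by
  obtain ⟨π, hπ⟩ := exists_mismatch_eq (S.lab U) (S.lab V)
  have hn' : (0 : ℝ) < n := by exact_mod_cast hn
  rw [hπ, mul_div_cancel₀ _ hn'.ne', Nat.cast_le]
  by_cases h : ∀ k, π k = k
  · refine Finset.card_le_card fun v hv => ?_
    rw [Finset.mem_filter] at hv
    simp only [Finset.mem_filter, Finset.mem_univ, true_and, h, S.lab_mem hv.1]
    have h1 := S.ne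
    have h2 := S.ne.symm
    by_cases hU : v ∈ U <;> by_cases hV : v ∈ V <;> simp_all
  · push Not at h
    obtain ⟨k, hk⟩ := h
    have h1 : S.dist U V ≤ S.I.card := Finset.card_filter_le _ _
    have h2 := S.large k
    have h3 : (Finset.univ.filter fun i => S.σ i = k) ⊆
        (Finset.univ.filter fun i => S.lab U i ≠ π (S.lab V i)) ∪ (S.I ∪ S.I.image S.s) := by
      intro v hv
      rw [Finset.mem_filter] at hv
      by_cases hI : v ∈ S.I
      · simp [hI]
      by_cases hI' : S.s v ∈ S.I
      · have : v ∈ S.I.image S.s := Finset.mem_image.2 ⟨S.s v, hI', S.invol v⟩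
        simp only [Finset.mem_union, this, or_true]
      · rw [Finset.mem_union]
        left
        simp only [Finset.mem_filter, Finset.mem_univ, true_and]
        rw [S.lab_notMem hI hI', S.lab_notMem hI hI', hv.2]
        exact fun h => hk h.symm
    have h4 := Finset.card_le_card h3
    have h5 := Finset.card_union_le
      (Finset.univ.filter fun i => S.lab U i ≠ π (S.lab V i)) (S.I ∪ S.I.image S.s)
    have h6 := Finset.card_union_le S.I (S.I.image S.s)
    have h7 : (S.I.image S.s).card ≤ S.I.card := Finset.card_image_le
    have h8 : hammingDist (S.lab U) (fun i => π (S.lab V i))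
        = (Finset.univ.filter fun i => S.lab U i ≠ π (S.lab V i)).card := rfl
    omega

/-- Assouad's lemma for swapped labelings: if single transpositions can not be detected, then
some labeling has a large expected mismatch. -/
lemma exists_le_expectedMismatch {a b κ : ℝ} (h : Params n a b) (hκ1 : κ ≤ 1)
    (M : Mechanism n K)
    (hM : ∀ U, ∀ v ∈ S.I, ∀ g : Labeling n K → ℝ, (∀ τ, 0 ≤ g τ) → (∀ τ, g τ ≤ 1) →
      κ * (graphMean a b (S.lab U) (outMean M g) - 1 / 2)
        ≤ graphMean a b (S.lab (symmDiff U {v})) (outMean M g)) :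
    ∃ U, S.I.card * κ / (8 * n) ≤ expectedMismatch a b (S.lab U) M := by
  have hn := h.cast_pos
  -- Decode an output to the nearest labeling of the cube; by the triangle inequality this at most
  -- doubles the loss.
  have hproj : ∀ τ : Labeling n K, ∃ V, ∀ U, mismatch (S.lab V) τ ≤ mismatch (S.lab U) τ :=
    fun τ => Finite.exists_min fun U => mismatch (S.lab U) τ
  choose proj hproj using hproj
  let g : Finset (Fin n) → Fin n → Labeling n K → ℝ := fun U v τ =>
    if (v ∈ U ↔ v ∈ proj τ) then 0 else 1
  have hg0 : ∀ U v τ, 0 ≤ g U v τ := fun U v τ => by simp only [g]; split_ifs <;> norm_num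
  have hg1 : ∀ U v τ, g U v τ ≤ 1 := fun U v τ => by simp only [g]; split_ifs <;> norm_num
  have hloss : ∀ U τ, ∑ v ∈ S.I, g U v τ ≤ 2 * n * mismatch (S.lab U) τ := by
    intro U τ
    have h1 := S.dist_le_mul_mismatch h.n_pos U (proj τ)
    have h2 := mismatch_triangle (S.lab U) τ (S.lab (proj τ))
    have h3 := hproj τ U
    have h4 : ∑ v ∈ S.I, g U v τ = S.dist U (proj τ) := by
      simp only [g, dist, Finset.card_filter, Nat.cast_sum]
      refine Finset.sum_congr rfl fun v _ => ?_
      split_ifs <;> simp_all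
    rw [h4]
    nlinarith
  let err : Finset (Fin n) → Fin n → ℝ := fun U v =>
    graphMean a b (S.lab U) (outMean M (g U v))
  have herr0 : ∀ U v, 0 ≤ err U v := fun U v => Finset.sum_nonneg fun G _ =>
    mul_nonneg (h.sbmProb_nonneg _ G) (outMean_nonneg M (hg0 U v) G)
  -- The tests at `U` and at the flipped `U` are complementary, so the comparison becomes `κ(1/2 -
  -- err) ≤ err'`.
  have hflip : ∀ U, ∀ v ∈ S.I, κ / 2 ≤ err U v + err (symmDiff U {v}) v := by
    intro U v hv
    have h1 : ∀ G, outMean M (g (symmDiff U {v}) v) G + outMean M (g U v) G = 1 := by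
      intro G
      rw [← sum_toReal_apply M G, outMean, outMean, ← Finset.sum_add_distrib]
      refine Finset.sum_congr rfl fun τ _ => ?_
      simp only [g, Finset.mem_symmDiff, Finset.mem_singleton]
      by_cases h1 : v ∈ U <;> by_cases h2 : v ∈ proj τ <;> simp [h1, h2]
    have h2 := hM U v hv (g (symmDiff U {v}) v) (hg0 _ _) (hg1 _ _)
    have h3 : graphMean a b (S.lab U) (outMean M (g (symmDiff U {v}) v)) + err U v = 1 := by
      rw [← graphMean_add]
      simp_rw [h1]
      exact graphMean_const a b _ 1
    have h4 := herr0 U v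
    have h5 : graphMean a b (S.lab U) (outMean M (g (symmDiff U {v}) v)) = 1 - err U v := by
      linarith
    rw [h5] at h2
    change _ ≤ err (symmDiff U {v}) v at h2
    nlinarith [mul_nonneg (sub_nonneg.2 hκ1) h4]
  have hsumv : ∀ v ∈ S.I, Fintype.card (Finset (Fin n)) * (κ / 4) ≤ ∑ U, err U v := by
    intro v hv
    have h1 : ∑ U : Finset (Fin n), err (symmDiff U {v}) v = ∑ U, err U v :=
      Equiv.sum_comp (Function.Involutive.toPerm (fun U : Finset (Fin n) => symmDiff U {v})
        (symmDiff_left_involutive {v})) fun U => err U v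
    have h2 : ∑ _U : Finset (Fin n), κ / 2 ≤ ∑ U, (err U v + err (symmDiff U {v}) v) :=
      Finset.sum_le_sum fun U _ => hflip U v hv
    rw [Finset.sum_add_distrib, h1, Finset.sum_const, Finset.card_univ, nsmul_eq_mul] at h2
    linarith
  have hU : ∀ U, ∑ v ∈ S.I, err U v ≤ 2 * n * expectedMismatch a b (S.lab U) M := by
    intro U
    simp only [err]
    rw [← graphMean_sum, expectedMismatch_eq, ← graphMean_const_mul]
    refine h.graphMean_mono _ fun G => ?_
    unfold outMean
    rw [Finset.sum_comm, Finset.mul_sum]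
    refine Finset.sum_le_sum fun τ _ => ?_
    rw [← Finset.mul_sum]
    calc _ ≤ _ := mul_le_mul_of_nonneg_left (hloss U τ) ENNReal.toReal_nonneg
      _ = _ := by ring
  by_contra! hlt
  have h1 : ∑ U, ∑ v ∈ S.I, err U v < ∑ _U : Finset (Fin n), S.I.card * κ / 4 := by
    refine Finset.sum_lt_sum_of_nonempty Finset.univ_nonempty fun U _ => (hU U).trans_lt ?_
    have := hlt U
    rw [lt_div_iff₀ (by positivity)] at this
    linarith
  rw [Finset.sum_comm, Finset.sum_const, Finset.card_univ, nsmul_eq_mul] at h1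
  have h2 := Finset.sum_le_sum hsumv
  rw [Finset.sum_const, nsmul_eq_mul] at h2
  linarith

end SwapSystem

lemma exists_swapSystem {n K : ℕ} {β : ℝ} (hK : 2 ≤ K) (hβ : 1 ≤ β)
    (hn : 3 * (β * K) ≤ n) {σ : Labeling n K} (hσ : σ ∈ balanced n K β) :
    ∃ S : SwapSystem n K, S.σ = σ ∧ (n : ℝ) / (6 * (β * K)) ≤ S.I.card := by
  have hK' : (2 : ℝ) ≤ K := by exact_mod_cast hK
  have hβK : 2 ≤ β * K := by nlinarith
  set x : ℝ := n / (3 * (β * K)) with hx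
  have hx1 : 1 ≤ x := by rw [hx, le_div_iff₀ (by positivity)]; linarith
  set T : ℕ := ⌊x⌋₊ with hT
  have hTx : (T : ℝ) ≤ x := Nat.floor_le (by linarith)
  have hTx' : x < T + 1 := Nat.lt_floor_add_one x
  have hT1 : (1 : ℝ) ≤ T := by exact_mod_cast Nat.floor_pos.2 hx1
  have hlarge : ∀ k, 3 * T ≤ (Finset.univ.filter fun i => σ i = k).card := by
    intro k
    have h1 := (hσ k).1
    have h2 : (n : ℝ) / (β * K) = 3 * x := by rw [hx]; field_simp
    have h3 : ((3 * T : ℕ) : ℝ) ≤ ((Finset.univ.filter fun i => σ i = k).card : ℝ) := by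
      push_cast; linarith
    exact_mod_cast h3
  let k₀ : Fin K := ⟨0, by omega⟩
  let k₁ : Fin K := ⟨1, by omega⟩
  have hne : k₀ ≠ k₁ := by simp [k₀, k₁]
  obtain ⟨I, hI, hIc⟩ := Finset.exists_subset_card_eq
    (by have := hlarge k₀; omega : T ≤ (Finset.univ.filter fun i => σ i = k₀).card)
  obtain ⟨J, hJ, hJc⟩ := Finset.exists_subset_card_eq
    (by have := hlarge k₁; omega : T ≤ (Finset.univ.filter fun i => σ i = k₁).card)
  have hI' : ∀ v ∈ I, σ v = k₀ := fun v hv => (Finset.mem_filter.1 (hI hv)).2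
  have hJ' : ∀ v ∈ J, σ v = k₁ := fun v hv => (Finset.mem_filter.1 (hJ hv)).2
  let e : I ≃ J := Finset.equivOfCardEq (hIc.trans hJc.symm)
  have hdisj : ∀ v ∈ J, v ∉ I := fun v hv hv' => hne ((hI' v hv').symm.trans (hJ' v hv))
  let s : Fin n → Fin n := fun v =>
    if h : v ∈ I then e ⟨v, h⟩ else if h : v ∈ J then e.symm ⟨v, h⟩ else v
  have hsI : ∀ v (h : v ∈ I), s v = e ⟨v, h⟩ := fun v h => by simp [s, h]
  have hsJ : ∀ v (h : v ∈ J), s v = e.symm ⟨v, h⟩ := fun v h => by simp [s, h, hdisj v h]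
  refine ⟨⟨σ, s, I, k₀, k₁, hne, ?_, hI', ?_, by rw [hIc]; exact hlarge⟩, rfl, ?_⟩
  · intro v
    by_cases h1 : v ∈ I
    · rw [hsI v h1, hsJ _ (e ⟨v, h1⟩).2]
      simp
    · by_cases h2 : v ∈ J
      · rw [hsJ v h2, hsI _ (e.symm ⟨v, h2⟩).2]
        simp
      · have : s v = v := by simp [s, h1, h2]
        rw [this, this]
  · intro v hv
    rw [hsI v hv]
    exact hJ' _ (e ⟨v, hv⟩).2
  · change _ ≤ (I.card : ℝ)
    rw [hIc]
    -- Since `T ≥ 1` and `x < T + 1`, the floor keeps at least half of `x`.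
    have : (n : ℝ) / (6 * (β * K)) = x / 2 := by rw [hx]; field_simp; ring
    rw [this]; linarith

/-! ### The two lower bounds on the risk -/

section lower
variable {n K : ℕ} {a b : ℝ}

/-- Serves both lower bounds, with `κ` a likelihood ratio or a privacy loss. The constant is `48 = 6
* 8`, from the size of the swap system and from Assouad's lemma. -/
lemma le_minimaxRisk_of_comparison {β ε κ : ℝ} (h : Params n a b) (hK : 2 ≤ K) (hβ : 1 ≤ β)
    (hn : 3 * (β * K) ≤ n) (hne : (balanced n K β).Nonempty) (hκ0 : 0 ≤ κ) (hκ1 : κ ≤ 1)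
    (hM : ∀ M : Mechanism n K, IsNodeDP ε M → ∀ (σ σ' : Labeling n K) (v w : Fin n),
      (∀ i, i ≠ v → i ≠ w → σ i = σ' i) → ∀ g : Labeling n K → ℝ, (∀ τ, 0 ≤ g τ) →
      (∀ τ, g τ ≤ 1) → κ * (graphMean a b σ (outMean M g) - 1 / 2)
        ≤ graphMean a b σ' (outMean M g)) (hε : 0 ≤ ε) :
    κ / (48 * (β * K)) ≤ minimaxRisk ε n K a b β := by
  obtain ⟨σ, hσ⟩ := hne
  obtain ⟨S, rfl, hS⟩ := exists_swapSystem hK hβ hn hσ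
  have hn' := h.cast_pos
  have hK' : (2 : ℝ) ≤ K := by exact_mod_cast hK
  -- Constant mechanisms are private. Over an empty family the real infimum would take the default
  -- value 0.
  have : Nonempty {M : Mechanism n K // IsNodeDP ε M} := by
    refine ⟨⟨fun _ => PMF.pure S.σ, isNodeDP_of_apply_le fun G G' _ τ => ?_⟩⟩
    refine le_mul_of_one_le_left zero_le ?_
    rw [← ENNReal.ofReal_one]
    exact ENNReal.ofReal_le_ofReal (Real.one_le_exp hε)
  refine le_ciInf fun M => ?_
  obtain ⟨U, hU⟩ := S.exists_le_expectedMismatch h hκ1 M.1 fun U v _ g hg0 hg1 =>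
    hM M.1 M.2 _ _ v (S.s v) (fun i h1 h2 => S.lab_symmDiff_singleton U h1 h2) g hg0 hg1
  refine le_trans (le_trans ?_ hU) (le_ciSup
    (f := fun σ : balanced n K β => expectedMismatch a b σ.1 M.1)
    (Set.finite_range _).bddAbove ⟨S.lab U, S.lab_mem_balanced hσ U⟩)
  have h1 : κ / (48 * (β * K)) = (n : ℝ) / (6 * (β * K)) * κ / (8 * n) := by
    field_simp; ring
  rw [h1]
  gcongr

theorem exp_signal_le_minimaxRisk {β ε ρ : ℝ} (h : Params n a b) (ha : 2 ≤ a) (hK : 2 ≤ K)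
    (hβ : 1 ≤ β) (hn : 3 * (β * K) ≤ n) (hne : (balanced n K β).Nonempty) (hρ0 : 0 < ρ)
    (hρ1 : ρ ≤ 1) (hρ : ρ * a ≤ b) (hε : 0 ≤ ε) :
    Real.exp (-((6 * -Real.log ρ + 4) * a)) / (48 * (β * K)) ≤ minimaxRisk ε n K a b β := by
  refine le_minimaxRisk_of_comparison h hK hβ hn hne (Real.exp_pos _).le ?_ ?_ hε
  · rw [Real.exp_le_one_iff]
    have := Real.log_nonpos hρ0.le hρ1
    nlinarith
  · intro M _ σ σ' v w hσ g hg0 hg1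
    exact graphMean_comparison h ha hρ0 hρ1 hρ hσ (outMean_nonneg M hg0) (outMean_le_one M hg1)

theorem exp_privacy_le_minimaxRisk {β ε : ℝ} (h : Params n a b) (hK : 2 ≤ K)
    (hβ : 1 ≤ β) (hn : 3 * (β * K) ≤ n) (hne : (balanced n K β).Nonempty) (hε : 0 ≤ ε) :
    Real.exp (-(2 * ε)) / (48 * (β * K)) ≤ minimaxRisk ε n K a b β := by
  refine le_minimaxRisk_of_comparison h hK hβ hn hne (Real.exp_pos _).le ?_ ?_ hε
  · rw [Real.exp_le_one_iff]; linarith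
  · intro M hM σ σ' v w hσ g hg0 _
    have h1 := hM.graphMean_outMean_le h hσ hg0
    have h2 := Real.exp_pos (-(2 * ε))
    linarith

end lower

end

/-! ### The signal is of order `a` -/

section signal
variable {n K : ℕ} {a b : ℝ}

/-- The non-edge part of the affinity alone is at least `1 - a/n ≥ exp(-2a/n)`. -/
lemma mul_renyiHalf_le (h : Params n a b) : n * renyiHalf n a b ≤ 4 * a := by
  have hn := h.cast_pos
  have hp := h.div_le
  have hp0 : 0 ≤ a / n := div_nonneg h.a_pos.le hn.le
  have hqp : b / n ≤ a / n := div_le_div_of_nonneg_right h.b_lt.le hn.le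
  have h1 : 1 - a / n ≤ Real.sqrt (a / n * (b / n)) + Real.sqrt ((1 - a / n) * (1 - b / n)) := by
    have h2 : 1 - a / n ≤ Real.sqrt ((1 - a / n) * (1 - b / n)) :=
      Real.le_sqrt_of_sq_le (by nlinarith)
    linarith [Real.sqrt_nonneg (a / n * (b / n))]
  have h3 : -(2 * (a / n)) ≤ Real.log
      (Real.sqrt (a / n * (b / n)) + Real.sqrt ((1 - a / n) * (1 - b / n))) := by
    rw [Real.le_log_iff_exp_le (by linarith)]
    exact (exp_neg_two_mul_le hp0 hp).trans h1
  unfold renyiHalf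
  calc _ ≤ (n : ℝ) * (4 * (a / n)) := mul_le_mul_of_nonneg_left (by linarith) hn.le
    _ = 4 * a := by field_simp

/-- By `log x ≤ x - 1` the divergence dominates the squared Hellinger distance, of which only `(√p -
√q)²` is kept. -/
lemma le_mul_renyiHalf (h : Params n a b) {ρ : ℝ} (hρ0 : 0 ≤ ρ) (hρ1 : ρ ≤ 1)
    (hρ : b ≤ ρ * a) : (1 - Real.sqrt ρ) ^ 2 * a ≤ n * renyiHalf n a b := by
  have hn := h.cast_pos
  have hp := h.div_le
  have hp0 : 0 ≤ a / n := div_nonneg h.a_pos.le hn.le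
  have hq0 : 0 ≤ b / n := div_nonneg h.b_nonneg hn.le
  have hqp : b / n ≤ a / n := div_le_div_of_nonneg_right h.b_lt.le hn.le
  have hq : b / n ≤ ρ * (a / n) := by
    rw [← mul_div_assoc]; exact div_le_div_of_nonneg_right hρ hn.le
  rw [renyiHalf, Real.sqrt_mul hp0, Real.sqrt_mul (by linarith)]
  set p := a / n with hpdef
  set q := b / n
  have s1 := Real.sq_sqrt hp0
  have s2 := Real.sq_sqrt hq0
  have s3 := Real.sq_sqrt (by linarith : 0 ≤ 1 - p)
  have s4 := Real.sq_sqrt (by linarith : 0 ≤ 1 - q)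
  have s5 : 0 < Real.sqrt (1 - p) := Real.sqrt_pos.2 (by linarith)
  have s6 : 0 < Real.sqrt (1 - q) := Real.sqrt_pos.2 (by linarith)
  have s7 := Real.sqrt_nonneg p
  have s8 := Real.sqrt_nonneg q
  have hpos : 0 < Real.sqrt p * Real.sqrt q + Real.sqrt (1 - p) * Real.sqrt (1 - q) := by
    positivity
  have hlog := Real.log_le_sub_one_of_pos hpos
  have h1 : (Real.sqrt p - Real.sqrt q) ^ 2 ≤ -2 * Real.log
      (Real.sqrt p * Real.sqrt q + Real.sqrt (1 - p) * Real.sqrt (1 - q)) := by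
    nlinarith [sq_nonneg (Real.sqrt (1 - p) - Real.sqrt (1 - q))]
  have h2 : (1 - Real.sqrt ρ) ^ 2 * p ≤ (Real.sqrt p - Real.sqrt q) ^ 2 := by
    have h3 : Real.sqrt q ≤ Real.sqrt ρ * Real.sqrt p := by
      rw [← Real.sqrt_mul hρ0]; exact Real.sqrt_le_sqrt hq
    have h4 : Real.sqrt ρ ≤ 1 := Real.sqrt_le_one.2 hρ1
    have h5 : 0 ≤ (1 - Real.sqrt ρ) * Real.sqrt p := mul_nonneg (by linarith) s7
    have h6 : (1 - Real.sqrt ρ) * Real.sqrt p ≤ Real.sqrt p - Real.sqrt q := by linarith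
    calc _ = ((1 - Real.sqrt ρ) * Real.sqrt p) ^ 2 := by rw [mul_pow, s1]
      _ ≤ _ := pow_le_pow_left₀ h5 h6 2
  calc _ = (n : ℝ) * ((1 - Real.sqrt ρ) ^ 2 * p) := by rw [hpdef]; field_simp
    _ ≤ _ := mul_le_mul_of_nonneg_left (h2.trans h1) hn.le

lemma signal_le {β : ℝ} (h : Params n a b) (hK : 2 ≤ K) (hβ : 1 ≤ β) :
    signal n K a b β ≤ 4 * a := by
  have hK' : (2 : ℝ) ≤ K := by exact_mod_cast hK
  have h1 := mul_renyiHalf_le h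
  have ha := h.a_pos
  have h2 : 1 ≤ β * K := by nlinarith
  unfold signal
  split_ifs
  · linarith
  · rw [div_le_iff₀ (by linarith)]
    nlinarith

lemma le_signal {β ρ : ℝ} (h : Params n a b) (hK : 2 ≤ K) (hβ : 1 ≤ β) (hρ0 : 0 ≤ ρ)
    (hρ1 : ρ ≤ 1) (hρ : b ≤ ρ * a) :
    (1 - Real.sqrt ρ) ^ 2 / (β * K) * a ≤ signal n K a b β := by
  have hK' : (2 : ℝ) ≤ K := by exact_mod_cast hK
  have h1 := le_mul_renyiHalf h hρ0 hρ1 hρ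
  have h2 : 2 ≤ β * K := by nlinarith
  have ha := h.a_pos
  have h3 : (1 - Real.sqrt ρ) ^ 2 / (β * K) * a ≤ n * renyiHalf n a b / (β * K) := by
    rw [div_mul_eq_mul_div]
    exact div_le_div_of_nonneg_right h1 (by linarith)
  unfold signal
  split_ifs
  · refine h3.trans (div_le_div_of_nonneg_left ?_ (by norm_num) h2)
    exact le_trans (by positivity) h1
  · exact h3

end signal

/-! ### Absorbing constants and asymptotics -/

/-- A quantity between two sums of two exponentials is itself such a sum, with intermediate
rates. -/
lemma exists_rates {c₁ C₁ c₂ C₂ x y r : ℝ} (h₁ : c₁ ≤ C₁) (h₂ : c₂ ≤ C₂)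
    (hlo : Real.exp (-C₁ * x) + Real.exp (-C₂ * y) ≤ r)
    (hhi : r ≤ Real.exp (-c₁ * x) + Real.exp (-c₂ * y)) :
    ∃ θ₁ ∈ Set.Icc c₁ C₁, ∃ θ₂ ∈ Set.Icc c₂ C₂,
      r = Real.exp (-θ₁ * x) + Real.exp (-θ₂ * y) := by
  -- Both rates move together along one parameter, so the intermediate value theorem in one variable
  -- suffices.
  let F : ℝ → ℝ := fun t => Real.exp (-(c₁ + t * (C₁ - c₁)) * x)
    + Real.exp (-(c₂ + t * (C₂ - c₂)) * y)
  have hF : ContinuousOn F (Set.Icc 0 1) := by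
    apply Continuous.continuousOn; fun_prop
  obtain ⟨t, ht, hr⟩ := intermediate_value_Icc' zero_le_one hF
    (show r ∈ Set.Icc (F 1) (F 0) by
      have h1 : c₁ + 1 * (C₁ - c₁) = C₁ := by ring
      have h2 : c₂ + 1 * (C₂ - c₂) = C₂ := by ring
      simp only [F, h1, h2, zero_mul, add_zero]
      exact ⟨hlo, hhi⟩)
  refine ⟨_, ⟨?_, ?_⟩, _, ⟨?_, ?_⟩, hr.symm⟩ <;> nlinarith [ht.1, ht.2]

lemma const_mul_exp_le {A c x : ℝ} (hx : 2 * A ≤ c * x) :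
    A * Real.exp (-(c * x)) ≤ Real.exp (-(c * x / 2)) := by
  have h1 : A ≤ Real.exp (c * x / 2) := by linarith [Real.add_one_le_exp (c * x / 2)]
  calc _ ≤ Real.exp (c * x / 2) * Real.exp (-(c * x)) :=
        mul_le_mul_of_nonneg_right h1 (Real.exp_pos _).le
    _ = _ := by rw [← Real.exp_add]; congr 1; ring

/-- The bound on `z` makes `exp(-z/2) ≤ n⁻²`, so half of the rate absorbs the factor `n` and the
constants. -/
lemma mul_exp_sub_one_le {n K F z : ℝ} (hn : 1 ≤ n) (hK : 0 ≤ K) (hF : 1 ≤ F)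
    (hnF : 2 * K * F ≤ n) (hz : 4 * Real.log n ≤ z) :
    F * (Real.exp (n * K * Real.exp (-z)) - 1) ≤ Real.exp (-(z / 2)) := by
  set y := Real.exp (-(z / 2)) with hy
  have hy0 : 0 < y := Real.exp_pos _
  have hyy : Real.exp (-z) = y * y := by rw [hy, ← Real.exp_add]; congr 1; ring
  have hyn : y * (n * n) ≤ 1 := by
    have h1 : Real.exp (2 * Real.log n) = n * n := by
      rw [two_mul, Real.exp_add, Real.exp_log (by linarith)]
    rw [← h1, hy, ← Real.exp_add, Real.exp_le_one_iff]
    linarith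
  have hw : 2 * F * (n * K * (y * y)) ≤ y := by
    have h1 : 2 * F * K * n * y ≤ 1 := by
      have : 2 * F * K * n ≤ n * n := by nlinarith
      nlinarith
    nlinarith
  rw [hyy]
  set w := n * K * (y * y)
  have hw0 : 0 ≤ w := by positivity
  have hy1 : y ≤ 1 := by
    refine le_trans ?_ hyn
    exact le_mul_of_one_le_right hy0.le (by nlinarith)
  have hw1 : |w| ≤ 1 := by
    rw [abs_of_nonneg hw0]; nlinarith
  have h2 := exp_sub_one_sub_le_sq hw1
  have h3 : Real.exp w - 1 ≤ 2 * w := by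
    rw [abs_of_nonneg hw0] at hw1
    nlinarith
  nlinarith [mul_le_mul_of_nonneg_left h3 (by linarith : 0 ≤ F)]

lemma tendsto_atTop_of_log_isBigO {a b : ℕ → ℝ} (h : ∀ᶠ n : ℕ in atTop, 0 ≤ b n ∧ b n < a n)
    (hlog : (fun n : ℕ => Real.log n) =O[atTop] a) : Tendsto a atTop atTop := by
  obtain ⟨C, hC, hb⟩ := hlog.exists_pos
  have h1 : Tendsto (fun n : ℕ => Real.log n / C) atTop atTop :=
    (Real.tendsto_log_atTop.comp tendsto_natCast_atTop_atTop).atTop_div_const hC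
  refine tendsto_atTop_mono' atTop ?_ h1
  filter_upwards [h, hb.bound] with n hn hbn
  rw [div_le_iff₀ hC]
  rw [Real.norm_eq_abs, Real.norm_eq_abs, abs_of_pos (hn.1.trans_lt hn.2)] at hbn
  linarith [le_abs_self (Real.log n)]

lemma eventually_params {a b : ℕ → ℝ} (h : ∀ᶠ n : ℕ in atTop, 0 ≤ b n ∧ b n < a n)
    (ha : a =o[atTop] (fun n : ℕ => (n : ℝ))) : ∀ᶠ n : ℕ in atTop, Params n (a n) (b n) := by
  filter_upwards [h, ha.bound (by norm_num : (0 : ℝ) < 1 / 2), eventually_gt_atTop 0]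
    with n hn hbn hpos
  refine ⟨hpos, hn.1, hn.2, ?_⟩
  rw [Real.norm_eq_abs, Real.norm_eq_abs, abs_of_pos (hn.1.trans_lt hn.2), Nat.abs_cast] at hbn
  linarith

end NodeSBM

end

/-! ### Choice of constants and conclusion -/

theorem corollary4p2
    (K : ℕ) (hK : 2 ≤ K)
    (β : ℝ) (hβ : 1 ≤ β) (hβK : 3 ≤ K → β < Real.sqrt (5 / 3))
    (ρlo ρhi : ℝ) (hρlo : 0 < ρlo) (hρ : ρlo ≤ ρhi) (hρhi : ρhi < 1) :
    ∃ L csig cpriv Csig Cpriv : ℝ,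
      0 < L ∧ 0 < csig ∧ 0 < cpriv ∧ 0 < Csig ∧ 0 < Cpriv ∧
      ∀ a b : ℕ → ℝ,
        (∀ᶠ n : ℕ in atTop, 0 ≤ b n ∧ b n < a n) →
        (∀ᶠ n : ℕ in atTop, ρlo ≤ b n / a n ∧ b n / a n ≤ ρhi) →
        a =o[atTop] (fun n : ℕ => (n : ℝ)) →
        b =o[atTop] (fun n : ℕ => (n : ℝ)) →
        (fun n : ℕ => Real.log n) =O[atTop] a →
        ∀ᶠ n : ℕ in atTop, (NodeSBM.balanced n K β).Nonempty →
          ∀ ε : ℝ, L * Real.log n ≤ ε →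
            (Real.exp (-Csig * NodeSBM.signal n K (a n) (b n) β) + Real.exp (-Cpriv * ε)
                ≤ NodeSBM.minimaxRisk ε n K (a n) (b n) β ∧
              NodeSBM.minimaxRisk ε n K (a n) (b n) β
                ≤ Real.exp (-csig * NodeSBM.signal n K (a n) (b n) β)
                  + Real.exp (-cpriv * ε)) ∧
            ∃ θsig ∈ Set.Icc csig Csig, ∃ θpriv ∈ Set.Icc cpriv Cpriv,
              NodeSBM.minimaxRisk ε n K (a n) (b n) β
                = Real.exp (-θsig * NodeSBM.signal n K (a n) (b n) β)
                  + Real.exp (-θpriv * ε) := by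
  open NodeSBM in
  have hK' : (2 : ℝ) ≤ K := by exact_mod_cast hK
  have hρhi0 : 0 < ρhi := hρlo.trans_le hρ
  set δ : ℝ := sepConst K β ρhi with hδ
  have hδ0 : 0 < δ := sepConst_pos hK hβ hρhi
  set c₁ : ℝ := δ ^ 2 / 4 with hc₁
  set c₂ : ℝ := δ / 12 with hc₂
  set c₃ : ℝ := 6 * -Real.log ρlo + 4 with hc₃
  set γ : ℝ := (1 - Real.sqrt ρhi) ^ 2 / (β * K) with hγ
  set D : ℝ := 48 * (β * K) with hD
  set A : ℝ := 12 / δ * (2 * K / δ + 1) with hA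
  have hc₁0 : 0 < c₁ := by positivity
  have hc₂0 : 0 < c₂ := by positivity
  have hD0 : 0 < D := by positivity
  have hγ0 : 0 < γ := by
    have h1 : Real.sqrt ρhi < 1 := by
      rw [Real.sqrt_lt' one_pos]; simpa using hρhi
    have h2 : 0 < 1 - Real.sqrt ρhi := by linarith
    positivity
  -- `4 / c₂` gives `c₂ε ≥ 4 log n`. In `c₁ / 8`, a factor 2 absorbs `A` and a factor 4 comes from
  -- `signal ≤ 4a`. The `+ 1` in `c₃ + 1` and in `3 = 2 + 1` absorbs `1/(2D)`. The maxima keep the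
  -- rate intervals nonempty.
  refine ⟨4 / c₂, c₁ / 8, c₂ / 2, max (c₁ / 8) ((c₃ + 1) / γ), max 3 (c₂ / 2),
    by positivity, by positivity, by positivity, lt_max_of_lt_left (by positivity),
    lt_max_of_lt_left (by norm_num), ?_⟩
  intro a b hab hratio hao _ hlog
  have hatop := tendsto_atTop_of_log_isBigO hab hlog
  have hlogn : Tendsto (fun n : ℕ => 4 / c₂ * Real.log n) atTop atTop :=
    (Real.tendsto_log_atTop.comp tendsto_natCast_atTop_atTop).const_mul_atTop (by positivity)
  filter_upwards [eventually_params hab hao, hratio, hatop.eventually_ge_atTop 2,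
    hatop.eventually_ge_atTop (2 * A / c₁), hatop.eventually_ge_atTop (2 * D),
    hlogn.eventually_ge_atTop (2 * D),
    tendsto_natCast_atTop_atTop.eventually_ge_atTop (3 * (β * K)),
    tendsto_natCast_atTop_atTop.eventually_ge_atTop (2 * K * (K.factorial : ℝ))]
    with n hP hr ha2 haA haD hlD hnK hnF hne ε hε
  have ha := hP.a_pos
  have hblo : ρlo * a n ≤ b n := (le_div_iff₀ ha).1 hr.1
  have hbhi : b n ≤ ρhi * a n := (div_le_iff₀ ha).1 hr.2
  have hn1 : (1 : ℝ) ≤ n := by exact_mod_cast hP.n_pos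
  have hεD : 2 * D ≤ ε := hlD.trans hε
  have hε0 : 0 ≤ ε := by linarith
  have hSle := signal_le (K := K) (β := β) hP hK hβ
  have hSge := le_signal (K := K) (β := β) hP hK hβ hρhi0.le hρhi.le hbhi
  rw [← hγ] at hSge
  set S := signal n K (a n) (b n) β
  have hS0 : 0 ≤ S := le_trans (by positivity) hSge
  have hupper : minimaxRisk ε n K (a n) (b n) β
      ≤ Real.exp (-(c₁ / 8) * S) + Real.exp (-(c₂ / 2) * ε) := by
    have h1 := minimaxRisk_le hP (by linarith) hK hβ hρhi0.le hρhi hbhi hε0 hne hδ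
    have e1 : δ ^ 2 * a n / 4 = c₁ * a n := by rw [hc₁]; ring
    have e2 : δ * ε / 12 = c₂ * ε := by rw [hc₂]; ring
    rw [e1, e2, ← hA] at h1
    have h2 : A * Real.exp (-(c₁ * a n)) ≤ Real.exp (-(c₁ / 8) * S) := by
      refine (const_mul_exp_le ?_).trans (Real.exp_le_exp.2 ?_)
      · rw [div_le_iff₀ hc₁0] at haA; linarith
      · nlinarith
    have h3 : K.factorial * (Real.exp (n * K * Real.exp (-(c₂ * ε))) - 1)
        ≤ Real.exp (-(c₂ / 2) * ε) := by
      have h4 := mul_exp_sub_one_le (z := c₂ * ε) hn1 (by linarith : (0 : ℝ) ≤ K)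
        (by exact_mod_cast Nat.factorial_pos K : (1 : ℝ) ≤ K.factorial) hnF
        (by rw [div_mul_eq_mul_div, div_le_iff₀ hc₂0] at hε; linarith)
      refine h4.trans (le_of_eq ?_)
      congr 1; ring
    linarith
  have hlower : Real.exp (-(max (c₁ / 8) ((c₃ + 1) / γ)) * S) + Real.exp (-(max 3 (c₂ / 2)) * ε)
      ≤ minimaxRisk ε n K (a n) (b n) β := by
    have h1 := exp_signal_le_minimaxRisk hP ha2 hK hβ hnK hne hρlo (hρ.trans hρhi.le) hblo hε0
    have h2 := exp_privacy_le_minimaxRisk hP hK hβ hnK hne hε0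
    rw [← hc₃, ← hD] at h1
    rw [← hD] at h2
    -- Each exponential is compared with half of a lower bound, since the risk dominates the average
    -- of its two lower bounds.
    have hhalf : ∀ x y : ℝ, 2 * D ≤ y → Real.exp (-(x + y)) ≤ Real.exp (-x) / D / 2 := by
      intro x y hy
      rw [div_div, le_div_iff₀ (by positivity), neg_add, Real.exp_add, mul_assoc]
      refine mul_le_of_le_one_right (Real.exp_pos _).le ?_
      rw [Real.exp_neg, inv_mul_le_one₀ (Real.exp_pos _)]
      linarith [Real.add_one_le_exp y]
    have h3 : Real.exp (-(max (c₁ / 8) ((c₃ + 1) / γ)) * S) ≤ Real.exp (-(c₃ * a n)) / D / 2 := by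
      refine (Real.exp_le_exp.2 ?_).trans (hhalf (c₃ * a n) (a n) haD)
      have e1 : (c₃ + 1) / γ * S ≤ max (c₁ / 8) ((c₃ + 1) / γ) * S :=
        mul_le_mul_of_nonneg_right (le_max_right _ _) hS0
      have hc₃0 : 0 ≤ c₃ + 1 := by
        have := Real.log_nonpos hρlo.le (hρ.trans hρhi.le)
        linarith
      have e2 : (c₃ + 1) / γ * (γ * a n) ≤ (c₃ + 1) / γ * S :=
        mul_le_mul_of_nonneg_left hSge (by positivity)
      have e3 : (c₃ + 1) / γ * (γ * a n) = (c₃ + 1) * a n := by field_simp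
      linarith
    have h4 : Real.exp (-(max 3 (c₂ / 2)) * ε) ≤ Real.exp (-(2 * ε)) / D / 2 := by
      refine (Real.exp_le_exp.2 ?_).trans (hhalf (2 * ε) ε hεD)
      have e1 : 3 * ε ≤ max 3 (c₂ / 2) * ε := mul_le_mul_of_nonneg_right (le_max_left _ _) hε0
      linarith
    linarith
  exact ⟨⟨hlower, hupper⟩, exists_rates (le_max_left _ _) (le_max_right _ _) hlower hupper⟩
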